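/- Let $k\ge 1$, let $1\le\Lambda<\infty$, and let $(X,Y(0),Y(1),A,U)$ be a random vector with law $P_o$, where $X$ takes values in a standard Borel space $\mathcal X$ (for instance a Borel subset of $\mathbb R^d$), $Y(0),Y(1)$ are real-valued, $A\in\{0,1\}$ and $U\in\mathbb R^k$. For a law $Q$ of such a vector say that $Q$ satisfies the marginal sensitivity model (MSM) with parameter $\Lambda$ if, under $Q$, $(Y(0),Y(1))$ is conditionally independent of $A$ given $(X,U)$, and \[ \frac1\Lambda\le\frac{\mathbb P_Q(A=1\mid X,U)/\mathbb P_Q(A=0\mid X,U)}{\mathbb P_Q(A=1\mid X)/\mathbb P_Q(A=0\mid X)}\le\Lambda\qquad Q\text{-a.s.} \] (in particular the four probabilities are a.s. nonzero). Let $P$ be the law of the observed data $(X,Y,A)$ with $Y=AY(1)+(1-A)Y(0)$ under $P_o$, and let $\mathcal P(\Lambda)$ be the set of all laws $Q$ on $\mathcal X\times\mathbb R^2\times\{0,1\}\times\mathbb R^k$ that satisfy the MSM with parameter $\Lambda$ and under which $(X,Y,A)$ has law $P$. For $Q\in\mathcal P(\Lambda)$ put $\mu_Q(x,a)=\mathbb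 E_Q[Y(a)\mid X=x]$ (the mean of the regular conditional law of $Y(a)$ given $X=x$) and $\tau_Q(x)=\mu_Q(x,1)-\mu_Q(x,0)$. Let \[ \mu^-_\Lambda(\cdot,a)=\inf_{Q\in\mathcal P(\Lambda)}\mu_Q(\cdot,a),\quad \mu^+_\Lambda(\cdot,a)=\sup_{Q\in\mathcal P(\Lambda)}\mu_Q(\cdot,a),\quad \tau^-_\Lambda=\inf_{Q\in\mathcal P(\Lambda)}\tau_Q,\quad \tau^+_\Lambda=\sup_{Q\in\mathcal P(\Lambda)}\tau_Q, \] where, since conditional means are determined only up to null sets, infima and suprema are taken in the order of almost sure inequality with respect to the law of $X$ (essential infimum and supremum of the family). Assume that $P_o$ satisfies the MSM with parameter $\Lambda$ and that $\mathbb E_{P_o}|Y|<\infty$. Then for every $Q\in\mathcal P(\Lambda)$ and $a\in\{0,1\}$ the conditional law of $Y(a)$ given $X=x$ under $Q$ has a finite first moment for almost every $x$, the bounds $\mu^\pm_\Lambda(\cdot,a)$ and $\tau^\pm_\Lambda$ exist as real-valued measurable functions, and there are $P_\tau^+,P_\tau^-\in\mathcal P(\Lambda)$ with \[ \tau_{P_\tau^+}(x)=\tau_\Lambda^+(x),\qquad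 \tau_{P_\tau^-}(x)=\tau_\Lambda^-(x)\qquad\text{for almost every }x . \] Moreover, for almost every $x$, \[ \tau^{+}_\Lambda(x)=\mu^{+}_\Lambda(x,1)-\mu^{-}_\Lambda(x,0),\qquad \tau^{-}_\Lambda(x)=\mu^{-}_\Lambda(x,1)-\mu^{+}_\Lambda(x,0). \] -/

import Mathlib

open MeasureTheory ProbabilityTheory

noncomputable section

namespace MSM

/-- Values of the full data vector `(X, (Y(0), Y(1)), A, U)`: covariates in `𝒳`, the two potential
outcomes, the binary treatment, and the unobserved confounders in `ℝᵏ`. -/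
abbrev FullData (𝒳 : Type*) (k : ℕ) : Type _ := 𝒳 × (Fin 2 → ℝ) × Fin 2 × (Fin k → ℝ)

variable {𝒳 : Type*} {k : ℕ}

/-- The covariates `X`. -/
def covX (o : FullData 𝒳 k) : 𝒳 := o.1

/-- The pair of potential outcomes, `a ↦ Y(a)`. -/
def potY (o : FullData 𝒳 k) : Fin 2 → ℝ := o.2.1

/-- The treatment `A`. -/
def trtA (o : FullData 𝒳 k) : Fin 2 := o.2.2.1

/-- The unobserved confounders `U`. -/
def confU (o : FullData 𝒳 k) : Fin k → ℝ := o.2.2.2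

/-- The observed outcome `Y = Y(A)`, that is, `A Y(1) + (1 - A) Y(0)`. -/
def obsY (o : FullData 𝒳 k) : ℝ := potY o (trtA o)

/-- The pair `(X, U)`. -/
def covXU (o : FullData 𝒳 k) : 𝒳 × (Fin k → ℝ) := (covX o, confU o)

variable [MeasurableSpace 𝒳]

theorem measurable_covX : Measurable (covX : FullData 𝒳 k → 𝒳) := measurable_fst

theorem measurable_covXU : Measurable (covXU : FullData 𝒳 k → 𝒳 × (Fin k → ℝ)) :=
  measurable_fst.prodMk (measurable_snd.comp (measurable_snd.comp measurable_snd))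

/-- The law of the observed data `(X, Y, A)` under `Q`. -/
def obsLaw (Q : ProbabilityMeasure (FullData 𝒳 k)) : Measure (𝒳 × ℝ × Fin 2) :=
  (Q : Measure (FullData 𝒳 k)).map (fun o => (covX o, obsY o, trtA o))

/-- The law of the covariates `X` under `Q`. -/
def covLaw (Q : ProbabilityMeasure (FullData 𝒳 k)) : Measure 𝒳 :=
  (Q : Measure (FullData 𝒳 k)).map covX

/-- The nominal propensity score `ℙ_Q(A = a | X)`, as a random variable. -/
def nominalProp (Q : ProbabilityMeasure (FullData 𝒳 k)) (a : Fin 2) : FullData 𝒳 k → ℝ :=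
  (Q : Measure (FullData 𝒳 k))⟦trtA ⁻¹' {a} | MeasurableSpace.comap covX inferInstance⟧

/-- The propensity score `ℙ_Q(A = a | X, U)` given covariates and confounders, as a random
variable. -/
def trueProp (Q : ProbabilityMeasure (FullData 𝒳 k)) (a : Fin 2) : FullData 𝒳 k → ℝ :=
  (Q : Measure (FullData 𝒳 k))⟦trtA ⁻¹' {a} | MeasurableSpace.comap covXU inferInstance⟧

/-- The marginal sensitivity model with parameter `Λ`, as a property of a law `Q` of the full data:
`(Y(0), Y(1))` and `A` are conditionally independent given `(X, U)`, and the odds ratio of the two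
propensity scores lies in `[1/Λ, Λ]` almost surely. As division by zero gives zero and `1/Λ > 0`,
the lower bound also says that all the probabilities in the ratio are nonzero, so that the ratio is
a genuine one. -/
structure MarginalSensitivity [StandardBorelSpace 𝒳] (Λ : ℝ)
    (Q : ProbabilityMeasure (FullData 𝒳 k)) : Prop where
  condIndep : potY ⟂ᵢ[covXU, measurable_covXU; (Q : Measure (FullData 𝒳 k))] trtA
  oddsRatio : ∀ᵐ o ∂(Q : Measure (FullData 𝒳 k)),
    1 / Λ ≤ (trueProp Q 1 o / trueProp Q 0 o) / (nominalProp Q 1 o / nominalProp Q 0 o) ∧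
    (trueProp Q 1 o / trueProp Q 0 o) / (nominalProp Q 1 o / nominalProp Q 0 o) ≤ Λ

/-- The uncertainty set `𝒫(Λ)` for the observed-data law `P`: all laws of the full data that satisfy
the marginal sensitivity model and induce `P` on the observed data. -/
def uncertaintySet [StandardBorelSpace 𝒳] (k : ℕ) (Λ : ℝ) (P : Measure (𝒳 × ℝ × Fin 2)) :
    Set (ProbabilityMeasure (FullData 𝒳 k)) :=
  {Q | MarginalSensitivity Λ Q ∧ obsLaw Q = P}

/-- The conditional law of `Y(a)` given `X = x` under `Q`. -/
def condLaw (Q : ProbabilityMeasure (FullData 𝒳 k)) (a : Fin 2) : Kernel 𝒳 ℝ :=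
  condDistrib (fun o => potY o a) covX (Q : Measure (FullData 𝒳 k))

/-- The conditional mean `μ_Q(x, a) = 𝔼_Q[Y(a) | X = x]`. -/
def condMean (Q : ProbabilityMeasure (FullData 𝒳 k)) (a : Fin 2) (x : 𝒳) : ℝ :=
  ∫ y, y ∂(condLaw Q a x)

/-- The conditional average treatment effect `τ_Q(x) = μ_Q(x, 1) - μ_Q(x, 0)`. -/
def cate (Q : ProbabilityMeasure (FullData 𝒳 k)) (x : 𝒳) : ℝ :=
  condMean Q 1 x - condMean Q 0 x

/-- `g` is the supremum of the family `F` of functions in the `ν`-almost-sure order (the essential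
supremum of the family): the supremum for families of conditional expectations, which are determined
only up to null sets. It is unique up to a `ν`-null set. -/
structure IsFamilyEssSup (ν : Measure 𝒳) (F : Set (𝒳 → ℝ)) (g : 𝒳 → ℝ) : Prop where
  measurable : Measurable g
  le : ∀ f ∈ F, ∀ᵐ x ∂ν, f x ≤ g x
  least : ∀ h : 𝒳 → ℝ, Measurable h → (∀ f ∈ F, ∀ᵐ x ∂ν, f x ≤ h x) → ∀ᵐ x ∂ν, g x ≤ h x

/-- `g` is the infimum of the family `F` of functions in the `ν`-almost-sure order (the essential
infimum of the family). It is unique up to a `ν`-null set. -/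
structure IsFamilyEssInf (ν : Measure 𝒳) (F : Set (𝒳 → ℝ)) (g : 𝒳 → ℝ) : Prop where
  measurable : Measurable g
  ge : ∀ f ∈ F, ∀ᵐ x ∂ν, g x ≤ f x
  greatest : ∀ h : 𝒳 → ℝ, Measurable h → (∀ f ∈ F, ∀ᵐ x ∂ν, h x ≤ f x) → ∀ᵐ x ∂ν, h x ≤ g x

theorem IsFamilyEssSup.ae_eq {ν : Measure 𝒳} {F : Set (𝒳 → ℝ)} {g g' : 𝒳 → ℝ}
    (h : IsFamilyEssSup ν F g) (h' : IsFamilyEssSup ν F g') : ∀ᵐ x ∂ν, g x = g' x := by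
  filter_upwards [h.least g' h'.measurable h'.le, h'.least g h.measurable h.le] with x h1 h2
  exact le_antisymm h1 h2

theorem IsFamilyEssInf.ae_eq {ν : Measure 𝒳} {F : Set (𝒳 → ℝ)} {g g' : 𝒳 → ℝ}
    (h : IsFamilyEssInf ν F g) (h' : IsFamilyEssInf ν F g') : ∀ᵐ x ∂ν, g x = g' x := by
  filter_upwards [h.greatest g' h'.measurable h'.ge, h'.greatest g h.measurable h.ge] with x h1 h2
  exact le_antisymm h2 h1

end MSM

end

/-! Write p_a for P(A = a | X), e_a for P(A = a | X, U), and F_a for the law of Y given X and A = a.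
Conditional independence gives E[e_a h(X, Y(a))] = E[p_a ∫ h dF_a], and the odds condition confines
p_a / e_a to [p_a + Λ⁻¹ p_{1-a}, p_a + Λ p_{1-a}]. Hence given X the law of Y(a) has a density with
respect to F_a between these two bounds (`lintegral_condLaw_bounds`), which depend on P alone. The
mean of such a law is largest when the density is the upper bound above some threshold and the lower
bound below it, and smallest in the reverse case (`integral_id_le_of_lintegral_le`).

The two arms can be made extreme at once by a single binary confounder V. Let V = b mark an upper
tail of both F_0 and F_1, with P(V = v | A = a) equal to 1/(Λ+1) if v = a and to Λ/(Λ+1) otherwise,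
whatever X is. By Bayes the odds ratio is P(V = v | A = 1) / P(V = v | A = 0), which is Λ or 1/Λ.
Where V = v, the density of Y(a) is P(V = v | X) / P(V = v | A = a), that is, p_a + Λ p_{1-a} if v =
a and p_a + Λ⁻¹ p_{1-a} if not. So the upper tail is weighted up for Y(b) and down for Y(1-b): one
law maximizes the mean of Y(b) and minimizes that of Y(1-b) (`exists_extremal`). Taking b = 1 and b
= 0 gives both extremes of τ together with the difference formulas. Only the two marginals of (Y(0),
Y(1)) given (X, V) matter, so they are coupled independently. -/

noncomputable section

namespace MSM

open Set Filter Topology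
open scoped ENNReal

/-! ### Quantiles and randomized upper tails, measurably in a parameter -/

section UpperTail

/-- The upper `c`-quantile of a measure on the line: the least point above which there is mass at
most `c`. -/
def upperQuantile (μ : Measure ℝ) (c : ℝ≥0∞) : ℝ := sInf {y | μ (Ioi y) ≤ c}

theorem exists_measure_Ioi_le (μ : Measure ℝ) [IsFiniteMeasure μ] {c : ℝ≥0∞} (hc : 0 < c) :
    ∃ y, μ (Ioi y) ≤ c := by
  have h : Tendsto (fun n : ℕ => μ (Ioi (n : ℝ))) atTop (𝓝 (μ (⋂ n : ℕ, Ioi (n : ℝ)))) :=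
    tendsto_measure_iInter_atTop (fun _ => measurableSet_Ioi.nullMeasurableSet)
      (fun m n hmn => Ioi_subset_Ioi (by exact_mod_cast hmn)) ⟨0, measure_ne_top _ _⟩
  have he : (⋂ n : ℕ, Ioi (n : ℝ)) = ∅ := by
    ext y
    obtain ⟨n, hn⟩ := exists_nat_ge y
    simpa using ⟨n, hn⟩
  rw [he, measure_empty] at h
  obtain ⟨n, hn⟩ := (h.eventually_lt_const hc).exists
  exact ⟨n, hn.le⟩

theorem bddBelow_measure_Ioi_le (μ : Measure ℝ) [IsProbabilityMeasure μ] {c : ℝ≥0∞} (hc : c < 1) :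
    BddBelow {y | μ (Ioi y) ≤ c} := by
  have h : Tendsto (fun n : ℕ => μ (Ioi (-n : ℝ))) atTop (𝓝 (μ (⋃ n : ℕ, Ioi (-n : ℝ)))) :=
    tendsto_measure_iUnion_atTop
      (fun m n hmn => Ioi_subset_Ioi (neg_le_neg (by exact_mod_cast hmn)))
  have he : (⋃ n : ℕ, Ioi (-n : ℝ)) = univ := by
    ext y
    obtain ⟨n, hn⟩ := exists_nat_gt (-y)
    simpa using ⟨n, by linarith⟩
  rw [he, measure_univ] at h
  obtain ⟨n, hn⟩ := (h.eventually_const_lt hc).exists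
  refine ⟨-n, fun y hy => ?_⟩
  by_contra! hlt
  exact absurd (hn.trans_le ((measure_mono (Ioi_subset_Ioi hlt.le)).trans hy)) (lt_irrefl _)

/-- Restricting to rational thresholds writes the sublevel sets of the quantile as countable unions,
which makes it measurable in a parameter. -/
theorem upperQuantile_lt_iff (μ : Measure ℝ) [IsProbabilityMeasure μ] {c : ℝ≥0∞} (hc : 0 < c)
    (hc1 : c < 1) (t : ℝ) :
    upperQuantile μ c < t ↔ ∃ r : ℚ, (r : ℝ) < t ∧ μ (Ioi (r : ℝ)) ≤ c := by
  rw [upperQuantile, csInf_lt_iff (bddBelow_measure_Ioi_le μ hc1) (exists_measure_Ioi_le μ hc)]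
  constructor
  · rintro ⟨y, hy, hyt⟩
    obtain ⟨r, hr1, hr2⟩ := exists_rat_btwn hyt
    exact ⟨r, hr2, (measure_mono (Ioi_subset_Ioi hr1.le)).trans hy⟩
  · rintro ⟨r, hr, h⟩
    exact ⟨r, h, hr⟩

theorem measure_Ioi_upperQuantile_le (μ : Measure ℝ) [IsProbabilityMeasure μ] {c : ℝ≥0∞}
    (hc : 0 < c) (hc1 : c < 1) : μ (Ioi (upperQuantile μ c)) ≤ c := by
  set q := upperQuantile μ c with hq
  obtain ⟨u, hu, hu1, hu2⟩ := exists_seq_strictAnti_tendsto q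
  have h : Tendsto (fun n : ℕ => μ (Ioi (u n))) atTop (𝓝 (μ (⋃ n : ℕ, Ioi (u n)))) :=
    tendsto_measure_iUnion_atTop (fun m n hmn => Ioi_subset_Ioi (hu.antitone hmn))
  have he : (⋃ n : ℕ, Ioi (u n)) = Ioi q := by
    ext y
    simp only [mem_iUnion, mem_Ioi]
    exact ⟨fun ⟨n, hn⟩ => (hu1 n).trans hn, fun hy => (hu2.eventually_lt_const hy).exists⟩
  rw [he] at h
  refine le_of_tendsto' h fun n => ?_
  obtain ⟨r, hr, hr2⟩ := (upperQuantile_lt_iff μ hc hc1 _).1 (hu1 n)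
  exact (measure_mono (Ioi_subset_Ioi hr.le)).trans hr2

theorem le_measure_Ici_upperQuantile (μ : Measure ℝ) [IsProbabilityMeasure μ] {c : ℝ≥0∞}
    (hc1 : c < 1) : c ≤ μ (Ici (upperQuantile μ c)) := by
  set q := upperQuantile μ c with hq
  obtain ⟨u, hu, hu1, hu2⟩ := exists_seq_strictMono_tendsto q
  have h : Tendsto (fun n : ℕ => μ (Ioi (u n))) atTop (𝓝 (μ (⋂ n : ℕ, Ioi (u n)))) :=
    tendsto_measure_iInter_atTop (fun _ => measurableSet_Ioi.nullMeasurableSet)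
      (fun m n hmn => Ioi_subset_Ioi (hu.monotone hmn)) ⟨0, measure_ne_top _ _⟩
  have he : (⋂ n : ℕ, Ioi (u n)) = Ici q := by
    ext y
    simp only [mem_iInter, mem_Ioi, mem_Ici]
    exact ⟨fun hy => le_of_tendsto' hu2 fun n => (hy n).le, fun hy n => (hu1 n).trans_le hy⟩
  rw [he] at h
  refine ge_of_tendsto' h fun n => ?_
  by_contra! hlt
  exact absurd (csInf_le (bddBelow_measure_Ioi_le μ hc1) (show u n ∈ {y | μ (Ioi y) ≤ c} from hlt.le))
    (not_le.2 (hu1 n))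

/-- For a Markov kernel to the line and levels in `(0, 1)` there is a measurable randomized test
that accepts the upper tail with exactly the given mass. -/
theorem exists_upperTail {α : Type*} [MeasurableSpace α] (κ : Kernel α ℝ) [IsMarkovKernel κ]
    {c : α → ℝ≥0∞} (hc : Measurable c) (hc0 : ∀ t, 0 < c t) (hc1 : ∀ t, c t < 1) :
    ∃ (q : α → ℝ) (w : α → ℝ → ℝ≥0∞), Measurable q ∧ Measurable (Function.uncurry w) ∧
      (∀ t y, w t y ≤ 1) ∧ (∀ t y, y < q t → w t y = 0) ∧ (∀ t y, q t < y → w t y = 1) ∧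
      ∀ t, ∫⁻ y, w t y ∂κ t = c t := by
  set q : α → ℝ := fun t => upperQuantile (κ t) (c t) with hq
  have hqm : Measurable q := by
    refine measurable_of_Iio fun s => ?_
    have : q ⁻¹' Iio s = ⋃ r : ℚ, {t | (r : ℝ) < s ∧ κ t (Ioi (r : ℝ)) ≤ c t} := by
      ext t
      simp [hq, upperQuantile_lt_iff (κ t) (hc0 t) (hc1 t)]
    rw [this]
    refine MeasurableSet.iUnion fun r => (MeasurableSet.const _).inter ?_
    exact measurableSet_le (κ.measurable_coe measurableSet_Ioi) hc
  -- The share of the atom at the quantile needed to reach level `c t`. Without an atom the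
  -- numerator vanishes too, and 0 / 0 = 0.
  set θ : α → ℝ≥0∞ := fun t => (c t - κ t (Ioi (q t))) / κ t {q t} with hθ
  have hIoi : Measurable fun t => κ t (Ioi (q t)) :=
    Kernel.measurable_kernel_prodMk_left (κ := κ) (t := {p : α × ℝ | q p.1 < p.2})
      (measurableSet_lt (by fun_prop) (by fun_prop))
  have hsing : Measurable fun t => κ t {q t} :=
    Kernel.measurable_kernel_prodMk_left (κ := κ) (t := {p : α × ℝ | p.2 = q p.1})
      (measurableSet_eq_fun (by fun_prop) (by fun_prop))
  have hθm : Measurable θ := (hc.sub hIoi).div hsing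
  have hle : ∀ t, c t - κ t (Ioi (q t)) ≤ κ t {q t} := fun t => by
    rw [tsub_le_iff_left, ← measure_union (by simp) (measurableSet_singleton _)]
    refine (le_measure_Ici_upperQuantile (κ t) (hc1 t)).trans (measure_mono fun y hy => ?_)
    rcases (show q t ≤ y from hy).lt_or_eq with h | h
    · exact Or.inl h
    · exact Or.inr h.symm
  have hθ1 : ∀ t, θ t ≤ 1 := fun t => ENNReal.div_le_of_le_mul (by simpa using hle t)
  refine ⟨q, fun t y => if q t < y then 1 else if y = q t then θ t else 0, hqm, ?_, ?_, ?_, ?_, ?_⟩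
  · refine Measurable.ite (measurableSet_lt (by fun_prop) (by fun_prop)) measurable_const ?_
    exact Measurable.ite (measurableSet_eq_fun (by fun_prop) (by fun_prop)) (by fun_prop)
      measurable_const
  · intro t y
    dsimp only
    split_ifs
    exacts [le_rfl, hθ1 t, zero_le]
  · intro t y h
    simp [h.not_gt, h.ne]
  · intro t y h
    simp [h]
  · intro t
    have : (fun y => if q t < y then 1 else if y = q t then θ t else 0) =
        fun y => (Ioi (q t)).indicator 1 y + ({q t} : Set ℝ).indicator (fun _ => θ t) y := by
      ext y
      by_cases h : q t < y
      · simp [h, h.ne']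
      · simp [h, Set.indicator_apply]
    rw [this, lintegral_add_left (measurable_one.indicator measurableSet_Ioi),
      lintegral_indicator_one measurableSet_Ioi,
      lintegral_indicator_const (measurableSet_singleton _)]
    have h1 : θ t * κ t {q t} = c t - κ t (Ioi (q t)) := by
      by_cases h0 : κ t {q t} = 0
      · have := hle t
        rw [h0] at this ⊢
        simpa using this.antisymm zero_le |>.symm
      · exact ENNReal.div_mul_cancel h0 (measure_ne_top _ _)
    rw [h1, add_tsub_cancel_of_le (measure_Ioi_upperQuantile_le (κ t) (hc0 t) (hc1 t))]

end UpperTail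

/-! ### Comparison of means across a threshold -/

section Comparison


/-- Moving mass across a point `q` upwards increases the mean. -/
theorem integral_id_le_of_lintegral_le {μ ν : Measure ℝ} [IsProbabilityMeasure μ]
    [IsProbabilityMeasure ν] (hμ : Integrable (fun y : ℝ => y) μ)
    (hν : Integrable (fun y : ℝ => y) ν) (q : ℝ)
    (hpos : ∫⁻ y, ENNReal.ofReal (y - q) ∂μ ≤ ∫⁻ y, ENNReal.ofReal (y - q) ∂ν)
    (hneg : ∫⁻ y, ENNReal.ofReal (q - y) ∂ν ≤ ∫⁻ y, ENNReal.ofReal (q - y) ∂μ) :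
    ∫ y, y ∂μ ≤ ∫ y, y ∂ν := by
  -- The mean is q + ∫ (y - q)⁺ - ∫ (q - y)⁺. Both parts vanish at q, so how an atom there is split
  -- plays no role.
  have key : ∀ ρ : Measure ℝ, IsProbabilityMeasure ρ → Integrable (fun y : ℝ => y) ρ →
      ∫⁻ y, ENNReal.ofReal (y - q) ∂ρ ≠ ∞ ∧ ∫⁻ y, ENNReal.ofReal (q - y) ∂ρ ≠ ∞ ∧
      ∫ y, y ∂ρ = (∫⁻ y, ENNReal.ofReal (y - q) ∂ρ).toReal
        - (∫⁻ y, ENNReal.ofReal (q - y) ∂ρ).toReal + q := by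
    intro ρ _ h
    have hi : Integrable (fun y : ℝ => y - q) ρ := h.sub (integrable_const q)
    have hi' : Integrable (fun y : ℝ => q - y) ρ := (integrable_const q).sub h
    refine ⟨hi.lintegral_lt_top.ne, hi'.lintegral_lt_top.ne, ?_⟩
    have := integral_eq_lintegral_pos_part_sub_lintegral_neg_part hi
    simp only [neg_sub] at this
    rw [← this, integral_sub h (integrable_const q)]
    simp
  obtain ⟨-, hμ2, hμ3⟩ := key μ inferInstance hμ
  obtain ⟨hν1, -, hν3⟩ := key ν inferInstance hν
  rw [hμ3, hν3]
  gcongr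

end Comparison

/-! ### Kernels determined by the observed law -/

variable {𝒳 : Type*} [MeasurableSpace 𝒳] {k : ℕ}

@[fun_prop]
theorem measurable_covX' : Measurable (covX : FullData 𝒳 k → 𝒳) := measurable_covX

@[fun_prop]
theorem measurable_covXU' : Measurable (covXU : FullData 𝒳 k → 𝒳 × (Fin k → ℝ)) := measurable_covXU

@[fun_prop]
theorem measurable_potY : Measurable (potY : FullData 𝒳 k → Fin 2 → ℝ) :=
  measurable_fst.comp measurable_snd

@[fun_prop]
theorem measurable_trtA : Measurable (trtA : FullData 𝒳 k → Fin 2) :=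
  measurable_fst.comp (measurable_snd.comp measurable_snd)

theorem measurable_apply_fin : Measurable fun p : (Fin 2 → ℝ) × Fin 2 => p.1 p.2 :=
  measurable_from_prod_countable_left fun a => measurable_pi_apply a

@[fun_prop]
theorem measurable_obsY : Measurable (obsY : FullData 𝒳 k → ℝ) :=
  measurable_apply_fin.comp (measurable_potY.prodMk measurable_trtA)

/-- The conditional law of the treatment given the covariates. -/
def trtKernel (Q : ProbabilityMeasure (FullData 𝒳 k)) : Kernel 𝒳 (Fin 2) :=
  condDistrib trtA covX (Q : Measure (FullData 𝒳 k))

/-- The conditional law of the observed outcome given covariates and treatment. -/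
def outcomeKernel (Q : ProbabilityMeasure (FullData 𝒳 k)) : Kernel (𝒳 × Fin 2) ℝ :=
  condDistrib obsY (fun o => (covX o, trtA o)) (Q : Measure (FullData 𝒳 k))

/-- The conditional law of the treatment given covariates and confounders. -/
def trtKernelXU (Q : ProbabilityMeasure (FullData 𝒳 k)) : Kernel (𝒳 × (Fin k → ℝ)) (Fin 2) :=
  condDistrib trtA covXU (Q : Measure (FullData 𝒳 k))

instance (Q : ProbabilityMeasure (FullData 𝒳 k)) : IsMarkovKernel (trtKernel Q) := by
  rw [trtKernel]; infer_instance

instance (Q : ProbabilityMeasure (FullData 𝒳 k)) : IsMarkovKernel (outcomeKernel Q) := by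
  rw [outcomeKernel]; infer_instance

instance (Q : ProbabilityMeasure (FullData 𝒳 k)) : IsMarkovKernel (trtKernelXU Q) := by
  rw [trtKernelXU]; infer_instance

instance (Q : ProbabilityMeasure (FullData 𝒳 k)) (a : Fin 2) : IsMarkovKernel (condLaw Q a) := by
  rw [condLaw]; infer_instance

instance (Q : ProbabilityMeasure (FullData 𝒳 k)) : IsProbabilityMeasure (covLaw Q) :=
  Measure.isProbabilityMeasure_map measurable_covX.aemeasurable

section ObservedLaw

variable {Q R : ProbabilityMeasure (FullData 𝒳 k)}

theorem map_obsLaw (Q : ProbabilityMeasure (FullData 𝒳 k)) {β : Type*} [MeasurableSpace β]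
    {f : 𝒳 × ℝ × Fin 2 → β} (hf : Measurable f) :
    (obsLaw Q).map f =
      (Q : Measure (FullData 𝒳 k)).map fun o => f (covX o, obsY o, trtA o) := by
  rw [obsLaw, Measure.map_map hf (by fun_prop)]
  rfl

theorem covLaw_congr (h : obsLaw Q = obsLaw R) : covLaw Q = covLaw R := by
  have := congrArg (fun μ => μ.map Prod.fst) h
  simp only [map_obsLaw _ measurable_fst] at this
  exact this

theorem trtKernel_congr (h : obsLaw Q = obsLaw R) : trtKernel Q = trtKernel R := by
  have hf : Measurable fun p : 𝒳 × ℝ × Fin 2 => (p.1, p.2.2) := by fun_prop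
  have := congrArg (fun μ => μ.map fun p : 𝒳 × ℝ × Fin 2 => (p.1, p.2.2)) h
  simp only [map_obsLaw _ hf] at this
  simp only [trtKernel, condDistrib, this]

theorem outcomeKernel_congr (h : obsLaw Q = obsLaw R) : outcomeKernel Q = outcomeKernel R := by
  have hf : Measurable fun p : 𝒳 × ℝ × Fin 2 => ((p.1, p.2.2), p.2.1) := by fun_prop
  have := congrArg (fun μ => μ.map fun p : 𝒳 × ℝ × Fin 2 => ((p.1, p.2.2), p.2.1)) h
  simp only [map_obsLaw _ hf] at this
  simp only [outcomeKernel, condDistrib, this]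

theorem lintegral_obs (Q : ProbabilityMeasure (FullData 𝒳 k)) {g : 𝒳 → ℝ → Fin 2 → ℝ≥0∞}
    (hg : Measurable fun p : (𝒳 × Fin 2) × ℝ => g p.1.1 p.2 p.1.2) :
    ∫⁻ o, g (covX o) (obsY o) (trtA o) ∂(Q : Measure (FullData 𝒳 k)) =
      ∫⁻ x, ∑ a, (∫⁻ y, g x y a ∂outcomeKernel Q (x, a)) * trtKernel Q x {a} ∂covLaw Q := by
  have h1 : covLaw Q ⊗ₘ trtKernel Q =
      (Q : Measure (FullData 𝒳 k)).map fun o => (covX o, trtA o) :=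
    compProd_map_condDistrib measurable_trtA.aemeasurable
  have h2 : (covLaw Q ⊗ₘ trtKernel Q) ⊗ₘ outcomeKernel Q =
      (Q : Measure (FullData 𝒳 k)).map fun o => ((covX o, trtA o), obsY o) := by
    rw [h1]
    exact compProd_map_condDistrib measurable_obsY.aemeasurable
  rw [← lintegral_map (f := fun p : (𝒳 × Fin 2) × ℝ => g p.1.1 p.2 p.1.2)
    (g := fun o : FullData 𝒳 k => ((covX o, trtA o), obsY o)) hg (by fun_prop), ← h2,
    Measure.lintegral_compProd hg,
    Measure.lintegral_compProd (Measurable.lintegral_kernel_prod_right' hg)]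
  simp only [lintegral_fintype]

/-- Consistency: on A = a the potential outcome Y(a) is the observed Y. -/
theorem lintegral_obs_arm (Q : ProbabilityMeasure (FullData 𝒳 k)) (a : Fin 2)
    {h : 𝒳 × ℝ → ℝ≥0∞} (hh : Measurable h) :
    ∫⁻ o, (if trtA o = a then h (covX o, potY o a) else 0) ∂(Q : Measure (FullData 𝒳 k)) =
      ∫⁻ x, trtKernel Q x {a} * ∫⁻ y, h (x, y) ∂outcomeKernel Q (x, a) ∂covLaw Q := by
  have hg : Measurable fun p : (𝒳 × Fin 2) × ℝ => if p.1.2 = a then h (p.1.1, p.2) else 0 :=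
    Measurable.ite ((measurableSet_singleton a).preimage (by fun_prop)) (by fun_prop) (by fun_prop)
  have h1 := lintegral_obs Q (g := fun x y a' => if a' = a then h (x, y) else 0) hg
  have h2 : ∀ o : FullData 𝒳 k, (if trtA o = a then h (covX o, potY o a) else 0) =
      if trtA o = a then h (covX o, obsY o) else 0 := fun o => by
    split_ifs with ho
    · rw [obsY, ho]
    · rfl
  simp only [h2, h1]
  congr with x
  rw [Finset.sum_eq_single a (fun b _ hb => by simp [hb]) (by simp)]
  simp [mul_comm]

end ObservedLaw

theorem lintegral_potY (Q : ProbabilityMeasure (FullData 𝒳 k)) (a : Fin 2)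
    {h : 𝒳 × ℝ → ℝ≥0∞} (hh : Measurable h) :
    ∫⁻ o, h (covX o, potY o a) ∂(Q : Measure (FullData 𝒳 k)) =
      ∫⁻ x, ∫⁻ y, h (x, y) ∂condLaw Q a x ∂covLaw Q := by
  have h1 : covLaw Q ⊗ₘ condLaw Q a =
      (Q : Measure (FullData 𝒳 k)).map fun o => (covX o, potY o a) :=
    compProd_map_condDistrib (by fun_prop)
  rw [← Measure.lintegral_compProd hh, h1, lintegral_map hh (by fun_prop)]

/-! ### Density bounds valid for every law in the model -/

section Sandwich

variable {Q : ProbabilityMeasure (FullData 𝒳 k)} {Λ : ℝ}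

/-- The density bound `ℙ(A = a | X) + c ℙ(A ≠ a | X)` of the conditional law of `Y(a)` with respect
to the conditional law of the outcome in arm `a`. -/
def armBound (π : Kernel 𝒳 (Fin 2)) (c : ℝ) (a : Fin 2) (x : 𝒳) : ℝ≥0∞ :=
  π x {a} + ENNReal.ofReal c * π x {1 - a}

theorem measurable_armBound (π : Kernel 𝒳 (Fin 2)) (c : ℝ) (a : Fin 2) :
    Measurable (armBound π c a) :=
  (π.measurable_coe (measurableSet_singleton _)).add
    ((π.measurable_coe (measurableSet_singleton _)).const_mul _)

theorem nominalProp_ae_eq (Q : ProbabilityMeasure (FullData 𝒳 k)) (a : Fin 2) :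
    nominalProp Q a =ᵐ[(Q : Measure (FullData 𝒳 k))] fun o => (trtKernel Q (covX o)).real {a} :=
  (condDistrib_ae_eq_condExp measurable_covX measurable_trtA (measurableSet_singleton a)).symm

theorem trueProp_ae_eq (Q : ProbabilityMeasure (FullData 𝒳 k)) (a : Fin 2) :
    trueProp Q a =ᵐ[(Q : Measure (FullData 𝒳 k))] fun o => (trtKernelXU Q (covXU o)).real {a} :=
  (condDistrib_ae_eq_condExp measurable_covXU measurable_trtA (measurableSet_singleton a)).symm

/-- Since x / 0 = 0, the positive lower bound excludes zero denominators; afterwards the odds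
inequalities can be cross-multiplied. -/
theorem odds_bounds {Λ e0 e1 p0 p1 : ℝ} (hΛ : 1 ≤ Λ) (he0 : 0 ≤ e0) (hp0 : 0 ≤ p0)
    (hp1 : 0 ≤ p1) (h1 : 1 / Λ ≤ (e1 / e0) / (p1 / p0)) (h2 : (e1 / e0) / (p1 / p0) ≤ Λ) :
    0 < p0 ∧ 0 < p1 ∧ e1 * p0 ≤ Λ * (e0 * p1) ∧ e0 * p1 ≤ Λ * (e1 * p0) := by
  have hpos : 0 < (e1 / e0) / (p1 / p0) := lt_of_lt_of_le (by positivity) h1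
  have he0' : 0 < e0 := he0.lt_of_ne fun h => by simp [← h] at hpos
  have hp0' : 0 < p0 := hp0.lt_of_ne fun h => by simp [← h] at hpos
  have hp1' : 0 < p1 := hp1.lt_of_ne fun h => by simp [← h] at hpos
  have he : (e1 / e0) / (p1 / p0) = (e1 * p0) / (e0 * p1) := by field_simp
  rw [he] at h1 h2
  refine ⟨hp0', hp1', (div_le_iff₀ (by positivity)).1 h2, ?_⟩
  rw [div_le_div_iff₀ (by positivity) (by positivity)] at h1
  linarith

/-- With e' = 1 - e, the odds inequality (1 - e) p ≤ Λ e p' rearranges to p ≤ (p + Λ p') e; the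
lower bound is symmetric. -/
theorem trtKernel_bounds [StandardBorelSpace 𝒳] (hΛ : 1 ≤ Λ) (hQ : MarginalSensitivity Λ Q) :
    ∀ᵐ o ∂(Q : Measure (FullData 𝒳 k)), ∀ a,
      trtKernel Q (covX o) {a} ≠ 0 ∧
      armBound (trtKernel Q) Λ⁻¹ a (covX o) * trtKernelXU Q (covXU o) {a} ≤
        trtKernel Q (covX o) {a} ∧
      trtKernel Q (covX o) {a} ≤
        armBound (trtKernel Q) Λ a (covX o) * trtKernelXU Q (covXU o) {a} := by
  filter_upwards [hQ.oddsRatio, nominalProp_ae_eq Q 0, nominalProp_ae_eq Q 1, trueProp_ae_eq Q 0,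
    trueProp_ae_eq Q 1] with o ho n0 n1 t0 t1
  rw [n0, n1, t0, t1] at ho
  have hsum : ∀ μ : Measure (Fin 2), IsProbabilityMeasure μ → μ.real {0} + μ.real {1} = 1 := by
    intro μ _
    rw [← Fin.sum_univ_two fun a => μ.real {a}, sum_measureReal_singleton]
    simp
  have hp := hsum (trtKernel Q (covX o)) inferInstance
  have he := hsum (trtKernelXU Q (covXU o)) inferInstance
  obtain ⟨hp0, hp1, h1, h2⟩ := odds_bounds hΛ measureReal_nonneg measureReal_nonneg
    measureReal_nonneg ho.1 ho.2
  have hr : ∀ a, trtKernel Q (covX o) {a} = ENNReal.ofReal ((trtKernel Q (covX o)).real {a}) :=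
    fun a => (ofReal_measureReal).symm
  have hs : ∀ a, trtKernelXU Q (covXU o) {a} =
      ENNReal.ofReal ((trtKernelXU Q (covXU o)).real {a}) := fun a => (ofReal_measureReal).symm
  have hm0 : 0 ≤ (trtKernelXU Q (covXU o)).real {0} := measureReal_nonneg
  have hm1 : 0 ≤ (trtKernelXU Q (covXU o)).real {1} := measureReal_nonneg
  rw [Fin.forall_fin_two]
  simp only [armBound, hr, hs, sub_zero, sub_self]
  generalize (trtKernel Q (covX o)).real {0} = p0 at *
  generalize (trtKernel Q (covX o)).real {1} = p1 at *
  generalize (trtKernelXU Q (covXU o)).real {0} = e0 at *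
  generalize (trtKernelXU Q (covXU o)).real {1} = e1 at *
  have hΛ0 : 0 < Λ := by linarith
  have key : ∀ {p p' e e' : ℝ}, 0 < p → 0 < p' → 0 ≤ e → p + p' = 1 → e + e' = 1 →
      e' * p ≤ Λ * (e * p') → e * p' ≤ Λ * (e' * p) →
      ENNReal.ofReal p ≠ 0 ∧
      (ENNReal.ofReal p + ENNReal.ofReal Λ⁻¹ * ENNReal.ofReal p') * ENNReal.ofReal e ≤
        ENNReal.ofReal p ∧
      ENNReal.ofReal p ≤
        (ENNReal.ofReal p + ENNReal.ofReal Λ * ENNReal.ofReal p') * ENNReal.ofReal e := by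
    intro p p' e e' hp hp' he hpp hee h1 h2
    obtain rfl : e' = 1 - e := by linarith
    refine ⟨by simpa using hp, ?_, ?_⟩
    · rw [← ENNReal.ofReal_mul (by positivity), ← ENNReal.ofReal_add hp.le (by positivity),
        ← ENNReal.ofReal_mul (by positivity)]
      refine ENNReal.ofReal_le_ofReal ?_
      have : Λ⁻¹ * (e * p') ≤ (1 - e) * p := (inv_mul_le_iff₀ hΛ0).2 h2
      linarith
    · rw [← ENNReal.ofReal_mul (by positivity), ← ENNReal.ofReal_add hp.le (by positivity),
        ← ENNReal.ofReal_mul (by positivity)]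
      refine ENNReal.ofReal_le_ofReal ?_
      linarith
  exact ⟨key hp0 hp1 hm0 hp he h1 h2,
    key hp1 hp0 hm1 (by linarith) ((add_comm _ _).trans he) h2 h1⟩

/-- Inverse probability weighting. -/
theorem lintegral_trtKernelXU_mul [StandardBorelSpace 𝒳] (hQ : MarginalSensitivity Λ Q)
    (a : Fin 2) {h : 𝒳 × ℝ → ℝ≥0∞} (hh : Measurable h) :
    ∫⁻ o, trtKernelXU Q (covXU o) {a} * h (covX o, potY o a) ∂(Q : Measure (FullData 𝒳 k)) =
      ∫⁻ x, trtKernel Q x {a} * ∫⁻ y, h (x, y) ∂outcomeKernel Q (x, a) ∂covLaw Q := by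
  rw [← lintegral_obs_arm Q a hh]
  have hind := (condIndepFun_iff_map_prod_eq_prod_condDistrib_prod_condDistrib measurable_potY
    measurable_trtA measurable_covXU).1 hQ.condIndep
  rw [← Measure.compProd_eq_comp_prod] at hind
  have hm : Measurable fun z => trtKernelXU Q z {a} :=
    Kernel.measurable_coe _ (measurableSet_singleton _)
  have hsm : MeasurableSet {p : (𝒳 × (Fin k → ℝ)) × (Fin 2 → ℝ) × Fin 2 | p.2.2 = a} :=
    (measurableSet_singleton a).preimage (by fun_prop)
  have hG1 : Measurable fun p : (𝒳 × (Fin k → ℝ)) × (Fin 2 → ℝ) × Fin 2 =>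
      trtKernelXU Q p.1 {a} * h (p.1.1, p.2.1 a) := by fun_prop
  have hG2 : Measurable fun p : (𝒳 × (Fin k → ℝ)) × (Fin 2 → ℝ) × Fin 2 =>
      if p.2.2 = a then h (p.1.1, p.2.1 a) else 0 :=
    Measurable.ite hsm (by fun_prop) (by fun_prop)
  have e1 := lintegral_map (μ := (Q : Measure (FullData 𝒳 k))) hG1
    (g := fun o => (covXU o, potY o, trtA o)) (by fun_prop)
  have e2 := lintegral_map (μ := (Q : Measure (FullData 𝒳 k))) hG2
    (g := fun o => (covXU o, potY o, trtA o)) (by fun_prop)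
  refine e1.symm.trans (Eq.trans ?_ e2)
  -- Given (X, U) the law of (Y(·), A) is a product, so integrating out A turns the indicator of A =
  -- a into the propensity score.
  rw [hind, Measure.lintegral_compProd hG1, Measure.lintegral_compProd hG2]
  congr with z
  have hz : Measurable fun b : (Fin 2 → ℝ) × Fin 2 => if b.2 = a then h (z.1, b.1 a) else 0 :=
    hG2.comp measurable_prodMk_left
  dsimp only
  rw [Kernel.lintegral_prod _ _ _ (by fun_prop), Kernel.lintegral_prod _ _ _ hz]
  congr with y
  dsimp only
  rw [lintegral_const, measure_univ, mul_one, lintegral_fintype,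
    Finset.sum_eq_single a (fun b _ hb => by simp [hb]) (by simp), mul_comm]
  simp [trtKernelXU]

theorem ae_trtKernel_ne_zero [StandardBorelSpace 𝒳] (hΛ : 1 ≤ Λ) (hQ : MarginalSensitivity Λ Q) :
    ∀ᵐ x ∂covLaw Q, ∀ a, trtKernel Q x {a} ≠ 0 := by
  have hm : ∀ a, Measurable fun x => trtKernel Q x {a} := fun a =>
    Kernel.measurable_coe _ (measurableSet_singleton _)
  rw [ae_all_iff]
  intro a
  refine (ae_map_iff measurable_covX.aemeasurable
    ((measurableSet_singleton 0).compl.preimage (hm a))).2 ?_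
  filter_upwards [trtKernel_bounds hΛ hQ] with o ho using (ho a).1

/-- The conditional law of `Y(a)` has density between `armBound Λ⁻¹` and `armBound Λ` with respect
to the conditional law of the outcome in arm `a`. -/
theorem lintegral_condLaw_bounds [StandardBorelSpace 𝒳] (hΛ : 1 ≤ Λ)
    (hQ : MarginalSensitivity Λ Q) (a : Fin 2) {f : 𝒳 × ℝ → ℝ≥0∞} (hf : Measurable f) :
    ∀ᵐ x ∂covLaw Q,
      armBound (trtKernel Q) Λ⁻¹ a x * ∫⁻ y, f (x, y) ∂outcomeKernel Q (x, a) ≤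
        ∫⁻ y, f (x, y) ∂condLaw Q a x ∧
      ∫⁻ y, f (x, y) ∂condLaw Q a x ≤
        armBound (trtKernel Q) Λ a x * ∫⁻ y, f (x, y) ∂outcomeKernel Q (x, a) := by
  have hm : Measurable fun x => trtKernel Q x {a} :=
    Kernel.measurable_coe _ (measurableSet_singleton _)
  have hb := measurable_armBound (trtKernel Q)
  have hF : Measurable fun x => ∫⁻ y, f (x, y) ∂outcomeKernel Q (x, a) :=
    Measurable.lintegral_kernel_prod_right' (κ := (outcomeKernel Q).comap (fun x => (x, a))
      (by fun_prop)) hf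
  have hL : Measurable fun x => ∫⁻ y, f (x, y) ∂condLaw Q a x :=
    Measurable.lintegral_kernel_prod_right' hf
  have hind : ∀ {s : Set 𝒳} (hs : MeasurableSet s) {u : 𝒳 → ℝ≥0∞} (hu : Measurable u),
      Measurable fun p : 𝒳 × ℝ => s.indicator u p.1 * f p := fun hs _ hu =>
    ((hu.indicator hs).comp measurable_fst).mul hf
  have hset : ∀ {s : Set 𝒳} (hs : MeasurableSet s) (u : 𝒳 → ℝ≥0∞) (hu : Measurable u),
      ∫⁻ x in s, u x * ∫⁻ y, f (x, y) ∂condLaw Q a x ∂covLaw Q =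
      ∫⁻ o, s.indicator u (covX o) * f (covX o, potY o a) ∂(Q : Measure (FullData 𝒳 k)) := by
    intro s hs u hu
    rw [lintegral_potY Q a (hind hs hu), ← lintegral_indicator hs]
    congr with x
    dsimp only
    rw [lintegral_const_mul _ (by fun_prop)]
    by_cases hx : x ∈ s <;> simp [hx]
  have hset' : ∀ {s : Set 𝒳} (hs : MeasurableSet s) (u : 𝒳 → ℝ≥0∞) (hu : Measurable u),
      ∫⁻ x in s, trtKernel Q x {a} * (u x * ∫⁻ y, f (x, y) ∂outcomeKernel Q (x, a)) ∂covLaw Q =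
      ∫⁻ o, trtKernelXU Q (covXU o) {a} * (s.indicator u (covX o) * f (covX o, potY o a))
        ∂(Q : Measure (FullData 𝒳 k)) := by
    intro s hs u hu
    rw [lintegral_trtKernelXU_mul hQ a (hind hs hu), ← lintegral_indicator hs]
    congr with x
    dsimp only
    rw [lintegral_const_mul _ (by fun_prop)]
    by_cases hx : x ∈ s <;> simp [hx]
  -- The factor p_a turns the integrals over each set of covariates into expectations whose
  -- integrands compare pointwise by `trtKernel_bounds`. It is cancelled at the end, being a.s.
  -- nonzero.
  have hup : ∀ᵐ x ∂covLaw Q, trtKernel Q x {a} * ∫⁻ y, f (x, y) ∂condLaw Q a x ≤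
      trtKernel Q x {a} *
        (armBound (trtKernel Q) Λ a x * ∫⁻ y, f (x, y) ∂outcomeKernel Q (x, a)) := by
    refine ae_le_of_forall_setLIntegral_le_of_sigmaFinite (hm.mul hL) fun s hs _ => ?_
    rw [hset hs _ hm, hset' hs _ (hb _ _)]
    refine lintegral_mono_ae ?_
    filter_upwards [trtKernel_bounds hΛ hQ] with o ho
    by_cases hx : covX o ∈ s
    · simp only [hx, indicator_of_mem, ← mul_assoc]
      rw [mul_comm (trtKernelXU Q _ _)]
      gcongr
      exact (ho a).2.2
    · simp [hx]
  have hlow : ∀ᵐ x ∂covLaw Q, trtKernel Q x {a} *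
        (armBound (trtKernel Q) Λ⁻¹ a x * ∫⁻ y, f (x, y) ∂outcomeKernel Q (x, a)) ≤
      trtKernel Q x {a} * ∫⁻ y, f (x, y) ∂condLaw Q a x := by
    refine ae_le_of_forall_setLIntegral_le_of_sigmaFinite (hm.mul ((hb _ _).mul hF))
      fun s hs _ => ?_
    rw [hset hs _ hm, hset' hs _ (hb _ _)]
    refine lintegral_mono_ae ?_
    filter_upwards [trtKernel_bounds hΛ hQ] with o ho
    by_cases hx : covX o ∈ s
    · simp only [hx, indicator_of_mem, ← mul_assoc]
      rw [mul_comm (trtKernelXU Q _ _)]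
      gcongr
      exact (ho a).2.1
    · simp [hx]
  filter_upwards [hup, hlow, ae_trtKernel_ne_zero hΛ hQ] with x h1 h2 h0
  exact ⟨(ENNReal.mul_le_mul_iff_right (h0 a) (measure_ne_top _ _)).1 h2,
    (ENNReal.mul_le_mul_iff_right (h0 a) (measure_ne_top _ _)).1 h1⟩

end Sandwich

/-! ### Full-data laws built from a binary confounder -/

set_option linter.unusedSectionVars false

/-- A binary confounder `V` on top of the outcome kernel `F` given covariates and treatment:
`prob a v` is the probability of `V = v` given `A = a`, and `weight v (x, a) y` is the probability
of `V = v` given `X = x`, `A = a` and `Y = y`. -/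
structure BinaryConfounder (F : Kernel (𝒳 × Fin 2) ℝ) where
  prob : Fin 2 → Fin 2 → ℝ≥0∞
  prob_ne_zero : ∀ a v, prob a v ≠ 0
  sum_prob : ∀ a, ∑ v, prob a v = 1
  weight : Fin 2 → 𝒳 × Fin 2 → ℝ → ℝ≥0∞
  measurable_weight : ∀ v, Measurable (Function.uncurry (weight v))
  sum_weight : ∀ z y, ∑ v, weight v z y = 1
  lintegral_weight : ∀ v z, ∫⁻ y, weight v z y ∂F z = prob z.2 v

namespace BinaryConfounder

variable {F : Kernel (𝒳 × Fin 2) ℝ} (V : BinaryConfounder F) (π : Kernel 𝒳 (Fin 2))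

theorem prob_ne_top (a v : Fin 2) : V.prob a v ≠ ∞ := by
  refine ne_top_of_le_ne_top ENNReal.one_ne_top ?_
  rw [← V.sum_prob a]
  exact Finset.single_le_sum (fun _ _ => zero_le) (Finset.mem_univ v)

theorem sum_apply_singleton (μ : Measure (Fin 2)) [IsProbabilityMeasure μ] : ∑ a, μ {a} = 1 := by
  rw [sum_measure_singleton]
  simp

/-- The probability of `V = v` given `X = x`. -/
def marginal (x : 𝒳) (v : Fin 2) : ℝ≥0∞ := ∑ a, π x {a} * V.prob a v

theorem measurable_marginal (v : Fin 2) : Measurable fun x => V.marginal π x v :=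
  Finset.measurable_sum _ fun _ _ => (π.measurable_coe (measurableSet_singleton _)).mul_const _

theorem measurable_uncurry_fin {α : Type*} [MeasurableSpace α] {f : α → Fin 2 → ℝ≥0∞}
    (hf : ∀ v, Measurable fun x => f x v) : Measurable (Function.uncurry f) :=
  measurable_from_prod_countable_left hf

variable [IsMarkovKernel π]

theorem sum_marginal (x : 𝒳) : ∑ v, V.marginal π x v = 1 := by
  simp only [marginal]
  rw [Finset.sum_comm]
  simp only [← Finset.mul_sum, V.sum_prob, mul_one, sum_apply_singleton]

theorem marginal_ne_zero (x : 𝒳) (v : Fin 2) : V.marginal π x v ≠ 0 := by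
  intro h
  have h0 : ∀ a, π x {a} = 0 := fun a => by
    have := (Finset.sum_eq_zero_iff.1 h) a (Finset.mem_univ a)
    exact (mul_eq_zero.1 this).resolve_right (V.prob_ne_zero a v)
  have := sum_apply_singleton (π x)
  simp [h0] at this

theorem marginal_ne_top (x : 𝒳) (v : Fin 2) : V.marginal π x v ≠ ∞ := by
  refine ne_top_of_le_ne_top ENNReal.one_ne_top ?_
  rw [← V.sum_marginal π x]
  exact Finset.single_le_sum (fun _ _ => zero_le) (Finset.mem_univ v)

/-- The conditional law of `V` given `X`. -/
def confKernel : Kernel 𝒳 (Fin 2) :=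
  Kernel.withDensity (Kernel.const 𝒳 Measure.count) (V.marginal π)

theorem lintegral_withDensity_count {α : Type*} [MeasurableSpace α] {f : α → Fin 2 → ℝ≥0∞}
    (hf : ∀ v, Measurable fun x => f x v) (x : α) (g : Fin 2 → ℝ≥0∞) :
    ∫⁻ v, g v ∂Kernel.withDensity (Kernel.const α Measure.count) f x = ∑ v, f x v * g v := by
  rw [Kernel.lintegral_withDensity _ (measurable_uncurry_fin hf) _ (measurable_of_countable g),
    Kernel.const_apply, lintegral_count, tsum_fintype]

theorem lintegral_confKernel (x : 𝒳) (g : Fin 2 → ℝ≥0∞) :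
    ∫⁻ v, g v ∂V.confKernel π x = ∑ v, V.marginal π x v * g v :=
  lintegral_withDensity_count (V.measurable_marginal π) x g

instance : IsMarkovKernel (V.confKernel π) where
  isProbabilityMeasure x := ⟨by
    rw [← lintegral_one, lintegral_confKernel]
    simp [V.sum_marginal π x]⟩

/-- The probability of `A = a` given `X = x` and `V = v`. -/
def posterior (z : 𝒳 × Fin 2) (a : Fin 2) : ℝ≥0∞ :=
  π z.1 {a} * V.prob a z.2 / V.marginal π z.1 z.2

theorem measurable_posterior (a : Fin 2) : Measurable fun z => V.posterior π z a := by
  have h1 : Measurable fun z : 𝒳 × Fin 2 => V.prob a z.2 :=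
    (measurable_of_countable (V.prob a)).comp measurable_snd
  have h2 : Measurable fun z : 𝒳 × Fin 2 => V.marginal π z.1 z.2 :=
    measurable_uncurry_fin (V.measurable_marginal π)
  exact (((π.measurable_coe (measurableSet_singleton _)).comp measurable_fst).mul h1).div h2

/-- Bayes' rule: both sides are the joint probability of A = a and V = v given X = x. -/
theorem marginal_mul_posterior (x : 𝒳) (v a : Fin 2) :
    V.marginal π x v * V.posterior π (x, v) a = π x {a} * V.prob a v :=
  ENNReal.mul_div_cancel (V.marginal_ne_zero π x v) (V.marginal_ne_top π x v)

theorem sum_posterior (z : 𝒳 × Fin 2) : ∑ a, V.posterior π z a = 1 := by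
  simp only [posterior, div_eq_mul_inv, ← Finset.sum_mul]
  exact ENNReal.mul_inv_cancel (V.marginal_ne_zero π _ _) (V.marginal_ne_top π _ _)

/-- The conditional law of `A` given `(X, V)`. -/
def postKernel : Kernel (𝒳 × Fin 2) (Fin 2) :=
  Kernel.withDensity (Kernel.const _ Measure.count) (V.posterior π)

theorem lintegral_postKernel (z : 𝒳 × Fin 2) (g : Fin 2 → ℝ≥0∞) :
    ∫⁻ a, g a ∂V.postKernel π z = ∑ a, V.posterior π z a * g a :=
  lintegral_withDensity_count (V.measurable_posterior π) z g

theorem postKernel_singleton (z : 𝒳 × Fin 2) (a : Fin 2) :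
    V.postKernel π z {a} = V.posterior π z a := by
  rw [← lintegral_indicator_one (measurableSet_singleton a), lintegral_postKernel,
    Finset.sum_eq_single a (fun b _ hb => by simp [hb]) (by simp)]
  simp

instance : IsMarkovKernel (V.postKernel π) where
  isProbabilityMeasure z := ⟨by
    rw [← lintegral_one, lintegral_postKernel]
    simp [V.sum_posterior π z]⟩

theorem measurable_armDensity (a : Fin 2) :
    Measurable (Function.uncurry fun (z : 𝒳 × Fin 2) (y : ℝ) =>
      V.weight z.2 (z.1, a) y / V.prob a z.2) := by
  have h : ∀ v, Measurable fun p : 𝒳 × ℝ => V.weight v (p.1, a) p.2 / V.prob a v := fun v =>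
    ((V.measurable_weight v).comp (f := fun p : 𝒳 × ℝ => ((p.1, a), p.2)) (by fun_prop)).div_const _
  exact (measurable_uncurry_fin h).comp (f := fun p : (𝒳 × Fin 2) × ℝ => ((p.1.1, p.2), p.1.2))
    (by fun_prop)

variable [IsMarkovKernel F]

/-- The conditional law of `Y(a)` given `(X, V)`. -/
def armKernel (a : Fin 2) : Kernel (𝒳 × Fin 2) ℝ :=
  Kernel.withDensity (F.comap (fun z : 𝒳 × Fin 2 => (z.1, a)) (by fun_prop))
    fun z y => V.weight z.2 (z.1, a) y / V.prob a z.2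

theorem lintegral_armKernel (a : Fin 2) (z : 𝒳 × Fin 2) {g : ℝ → ℝ≥0∞} (hg : Measurable g) :
    ∫⁻ y, g y ∂V.armKernel a z =
      (∫⁻ y, V.weight z.2 (z.1, a) y * g y ∂F (z.1, a)) / V.prob a z.2 := by
  have hw : Measurable (V.weight z.2 (z.1, a)) := (V.measurable_weight z.2).of_uncurry_left
  rw [armKernel, Kernel.lintegral_withDensity _ (V.measurable_armDensity a) _ hg,
    Kernel.comap_apply, div_eq_mul_inv, ← lintegral_mul_const _ (by fun_prop)]
  congr with y
  rw [div_eq_mul_inv]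
  ring

instance (a : Fin 2) : IsMarkovKernel (V.armKernel a) where
  isProbabilityMeasure z := ⟨by
    rw [← lintegral_one, V.lintegral_armKernel a z measurable_const]
    simp only [mul_one, V.lintegral_weight]
    exact ENNReal.div_self (V.prob_ne_zero _ _) (V.prob_ne_top _ _)⟩

/-- The conditional law of `(Y(0), Y(1))` given `(X, V)`, with independent components. -/
def potKernel : Kernel (𝒳 × Fin 2) (Fin 2 → ℝ) :=
  (V.armKernel 0 ×ₖ V.armKernel 1).map fun p => ![p.1, p.2]

theorem measurable_vecCons : Measurable fun p : ℝ × ℝ => ![p.1, p.2] := by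
  rw [measurable_pi_iff, Fin.forall_fin_two]
  exact ⟨measurable_fst, measurable_snd⟩

instance : IsMarkovKernel V.potKernel := Kernel.IsMarkovKernel.map _ measurable_vecCons

theorem lintegral_potKernel (a : Fin 2) (z : 𝒳 × Fin 2) {g : ℝ → ℝ≥0∞} (hg : Measurable g) :
    ∫⁻ y, g (y a) ∂V.potKernel z = ∫⁻ y, g y ∂V.armKernel a z := by
  rw [potKernel, Kernel.lintegral_map _ measurable_vecCons _ (by fun_prop)]
  revert a
  rw [Fin.forall_fin_two]
  constructor
  · rw [Kernel.lintegral_prod _ _ _ (by fun_prop)]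
    simp
  · rw [Kernel.lintegral_prod _ _ _ (by fun_prop)]
    simp

/-- The value of the confounder vector that encodes `V = v`. -/
def encode (k : ℕ) (v : Fin 2) : Fin k → ℝ := fun _ => (v : ℕ)

/-- The value of `V` encoded by a confounder vector. -/
def decode (u : Fin k → ℝ) : Fin 2 := if u = 0 then 0 else 1

theorem measurable_decode : Measurable (decode : (Fin k → ℝ) → Fin 2) :=
  Measurable.ite (measurableSet_singleton 0) measurable_const measurable_const

theorem decode_encode (hk : 1 ≤ k) (v : Fin 2) : decode (encode k v) = v := by
  revert v
  rw [Fin.forall_fin_two]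
  constructor
  · rw [decode, if_pos (by ext; simp [encode])]
  -- A coordinate is needed to tell the two encoded values apart; this is where `1 ≤ k` enters.
  · rw [decode, if_neg fun h => by simpa [encode] using congrFun h ⟨0, hk⟩]

theorem measurable_prodMap_decode :
    Measurable (Prod.map id decode : 𝒳 × (Fin k → ℝ) → 𝒳 × Fin 2) :=
  measurable_id.prodMap measurable_decode

/-- The conditional law of `(Y(0), Y(1))` given `(X, U)`. -/
def potKernelXU (k : ℕ) : Kernel (𝒳 × (Fin k → ℝ)) (Fin 2 → ℝ) :=
  V.potKernel.comap (Prod.map id decode) measurable_prodMap_decode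

/-- The conditional law of `A` given `(X, U)`. -/
def postKernelXU (k : ℕ) : Kernel (𝒳 × (Fin k → ℝ)) (Fin 2) :=
  (V.postKernel π).comap (Prod.map id decode) measurable_prodMap_decode

instance : IsMarkovKernel (V.potKernelXU k) := by rw [potKernelXU]; infer_instance

instance : IsMarkovKernel (V.postKernelXU π k) := by rw [postKernelXU]; infer_instance

/-- The joint law of `(X, U)`. -/
def covXULaw (k : ℕ) (ν : Measure 𝒳) : Measure (𝒳 × (Fin k → ℝ)) :=
  ν ⊗ₘ (V.confKernel π).map (encode k)

theorem measurable_encode : Measurable (encode k) := measurable_of_countable _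

instance : IsMarkovKernel ((V.confKernel π).map (encode k)) :=
  Kernel.IsMarkovKernel.map _ measurable_encode

variable (ν : Measure 𝒳) [IsProbabilityMeasure ν]

instance : IsProbabilityMeasure (V.covXULaw π k ν) := by rw [covXULaw]; infer_instance

theorem measurable_rearrange : Measurable
    fun p : (𝒳 × (Fin k → ℝ)) × (Fin 2 → ℝ) × Fin 2 =>
      ((p.1.1, p.2.1, p.2.2, p.1.2) : FullData 𝒳 k) :=
   (measurable_fst.comp measurable_fst).prodMk ((measurable_fst.comp measurable_snd).prodMk
    ((measurable_snd.comp measurable_snd).prodMk (measurable_snd.comp measurable_fst)))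

/-- The law of the full data. -/
def law (k : ℕ) : ProbabilityMeasure (FullData 𝒳 k) :=
  ⟨(V.covXULaw π k ν ⊗ₘ (V.potKernelXU k ×ₖ V.postKernelXU π k)).map
    fun p => (p.1.1, p.2.1, p.2.2, p.1.2),
    Measure.isProbabilityMeasure_map measurable_rearrange.aemeasurable⟩

theorem map_law : (V.law π ν k : Measure (FullData 𝒳 k)).map (fun o => (covXU o, potY o, trtA o)) =
    V.covXULaw π k ν ⊗ₘ (V.potKernelXU k ×ₖ V.postKernelXU π k) := by
  change Measure.map _ (Measure.map _ _) = _
  rw [Measure.map_map (by fun_prop) measurable_rearrange]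
  exact Measure.map_id

theorem map_law_covXU : (V.law π ν k : Measure (FullData 𝒳 k)).map covXU = V.covXULaw π k ν := by
  have h := congrArg Measure.fst (V.map_law π ν (k := k))
  rwa [Measure.fst_compProd, Measure.fst_map_prodMk (by fun_prop)] at h

theorem covLaw_law : covLaw (V.law π ν k) = ν := by
  have h := congrArg Measure.fst (V.map_law_covXU π ν (k := k))
  rw [covXULaw, Measure.fst_compProd] at h
  refine Eq.trans ?_ h
  rw [Measure.fst, Measure.map_map measurable_fst measurable_covXU]
  rfl

theorem condDistrib_potY_law :
    condDistrib potY covXU (V.law π ν k : Measure (FullData 𝒳 k)) =ᵐ[V.covXULaw π k ν]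
      V.potKernelXU k := by
  have h := congrArg (Measure.map (Prod.map id Prod.fst)) (V.map_law π ν (k := k))
  rw [← Measure.compProd_map measurable_fst, ← Kernel.fst_eq, Kernel.fst_prod,
    Measure.map_map (by fun_prop) (by fun_prop), ← V.map_law_covXU π ν] at h
  rw [← V.map_law_covXU π ν]
  exact condDistrib_ae_eq_of_measure_eq_compProd _ (by fun_prop) h

theorem condDistrib_trtA_law :
    trtKernelXU (V.law π ν k) =ᵐ[V.covXULaw π k ν] V.postKernelXU π k := by
  have h := congrArg (Measure.map (Prod.map id Prod.snd)) (V.map_law π ν (k := k))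
  rw [← Measure.compProd_map measurable_snd, ← Kernel.snd_eq, Kernel.snd_prod,
    Measure.map_map (by fun_prop) (by fun_prop), ← V.map_law_covXU π ν] at h
  rw [← V.map_law_covXU π ν]
  exact condDistrib_ae_eq_of_measure_eq_compProd _ (by fun_prop) h

/-- The law was built as a product kernel over (X, U), whose factors are the conditional laws by
uniqueness of disintegrations. -/
theorem condIndep_law [StandardBorelSpace 𝒳] :
    potY ⟂ᵢ[covXU, measurable_covXU; (V.law π ν k : Measure (FullData 𝒳 k))] trtA := by
  rw [condIndepFun_iff_map_prod_eq_prod_condDistrib_prod_condDistrib measurable_potY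
    measurable_trtA measurable_covXU, ← Measure.compProd_eq_comp_prod, map_law, map_law_covXU]
  refine Measure.compProd_congr ?_
  filter_upwards [V.condDistrib_potY_law π ν (k := k), V.condDistrib_trtA_law π ν (k := k)]
    with z h1 h2
  rw [trtKernelXU] at h2
  rw [Kernel.prod_apply, Kernel.prod_apply, h1, h2]

theorem lintegral_law (hk : 1 ≤ k) {g : 𝒳 → (Fin 2 → ℝ) → Fin 2 → ℝ≥0∞}
    (hg : Measurable fun p : 𝒳 × (Fin 2 → ℝ) × Fin 2 => g p.1 p.2.1 p.2.2) :
    ∫⁻ o, g (covX o) (potY o) (trtA o) ∂(V.law π ν k : Measure (FullData 𝒳 k)) =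
      ∫⁻ x, ∑ v, V.marginal π x v *
        ∑ a, V.posterior π (x, v) a * ∫⁻ y, g x y a ∂V.potKernel (x, v) ∂ν := by
  have hG : Measurable fun p : (𝒳 × (Fin k → ℝ)) × (Fin 2 → ℝ) × Fin 2 =>
      g p.1.1 p.2.1 p.2.2 :=
    hg.comp (f := fun p : (𝒳 × (Fin k → ℝ)) × (Fin 2 → ℝ) × Fin 2 => (p.1.1, p.2.1, p.2.2))
      (by fun_prop)
  have h1 := lintegral_map (μ := (V.law π ν k : Measure (FullData 𝒳 k))) hG
    (g := fun o => (covXU o, potY o, trtA o)) (by fun_prop)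
  refine h1.symm.trans ?_
  rw [map_law, Measure.lintegral_compProd hG, covXULaw,
    Measure.lintegral_compProd (Measurable.lintegral_kernel_prod_right' hG)]
  congr with x
  have hx : Measurable fun p : (Fin 2 → ℝ) × Fin 2 => g x p.1 p.2 := hg.comp measurable_prodMk_left
  have hx' : Measurable fun u : Fin k → ℝ => ∫⁻ p : (Fin 2 → ℝ) × Fin 2, g x p.1 p.2
      ∂(V.potKernelXU k ×ₖ V.postKernelXU π k) (x, u) :=
    (Measurable.lintegral_kernel_prod_right' hG).comp measurable_prodMk_left
  rw [Kernel.lintegral_map _ measurable_encode _ hx', lintegral_confKernel]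
  congr with v
  -- Treatment goes outside, so that for fixed a an integrand in the observed outcome involves only
  -- Y(a).
  rw [Kernel.lintegral_prod_symm _ _ _ hx, potKernelXU, postKernelXU]
  simp only [Kernel.comap_apply, Prod.map_apply, id, decode_encode hk, lintegral_postKernel]

/-- By Bayes the joint weight is P(A = a | X) P(V = v | A = a), whose second factor cancels the
normalization of the arm laws. -/
theorem marginal_mul_sum (x : 𝒳) (I : Fin 2 → Fin 2 → ℝ≥0∞) :
    ∑ v, V.marginal π x v * ∑ a, V.posterior π (x, v) a * (I a v / V.prob a v) =
      ∑ a, (∑ v, I a v) * π x {a} := by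
  simp only [Finset.mul_sum, Finset.sum_mul]
  rw [Finset.sum_comm]
  refine Finset.sum_congr rfl fun a _ => Finset.sum_congr rfl fun v _ => ?_
  rw [← mul_assoc, V.marginal_mul_posterior, mul_assoc,
    ENNReal.mul_div_cancel (V.prob_ne_zero a v) (V.prob_ne_top a v), mul_comm]

theorem sum_lintegral_weight_mul (z : 𝒳 × Fin 2) {g : ℝ → ℝ≥0∞} (hg : Measurable g) :
    ∑ v, ∫⁻ y, V.weight v z y * g y ∂F z = ∫⁻ y, g y ∂F z := by
  have hw : ∀ v, Measurable (V.weight v z) := fun v => (V.measurable_weight v).of_uncurry_left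
  rw [← lintegral_finsetSum (f := fun v y => V.weight v z y * g y) _ fun v _ => (hw v).mul hg]
  simp only [← Finset.sum_mul, V.sum_weight, one_mul]

/-- Given X, the law of Y(a) mixes the arm laws over V given X alone; treatment integrates out
because the posteriors sum to one. -/
theorem condLaw_law (hk : 1 ≤ k) (a : Fin 2) {h : 𝒳 × ℝ → ℝ≥0∞} (hh : Measurable h) :
    ∀ᵐ x ∂ν, ∫⁻ y, h (x, y) ∂condLaw (V.law π ν k) a x =
      ∑ v, V.marginal π x v *
        ((∫⁻ y, V.weight v (x, a) y * h (x, y) ∂F (x, a)) / V.prob a v) := by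
  have hw : ∀ v, Measurable fun x => ∫⁻ y, V.weight v (x, a) y * h (x, y) ∂F (x, a) := fun v =>
    Measurable.lintegral_kernel_prod_right' (κ := F.comap (fun x => (x, a)) (by fun_prop))
      (f := fun p : 𝒳 × ℝ => V.weight v (p.1, a) p.2 * h p)
      (((V.measurable_weight v).comp (f := fun p : 𝒳 × ℝ => ((p.1, a), p.2))
        (by fun_prop)).mul hh)
  have hm := V.measurable_marginal π
  refine ae_eq_of_forall_setLIntegral_eq_of_sigmaFinite
    (Measurable.lintegral_kernel_prod_right' hh)
    (Finset.measurable_sum _ fun v _ => (hm v).mul ((hw v).div_const _)) fun s hs _ => ?_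
  have hind : Measurable fun p : 𝒳 × ℝ => s.indicator 1 p.1 * h p :=
    ((measurable_one.indicator hs).comp measurable_fst).mul hh
  have hp := lintegral_potY (V.law π ν k) a hind
  have hl := V.lintegral_law π ν hk (g := fun x y _ => s.indicator 1 x * h (x, y a))
    (((measurable_one.indicator hs).comp measurable_fst).mul (by fun_prop))
  rw [covLaw_law] at hp
  rw [← lintegral_indicator hs, ← lintegral_indicator hs]
  refine Eq.trans ?_ ((hp.symm.trans hl).trans ?_)
  · congr with x
    by_cases hx : x ∈ s <;> simp [hx]
  · congr with x
    have hx' : Measurable fun y => h (x, y) := by fun_prop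
    by_cases hx : x ∈ s
    · simp only [hx, indicator_of_mem, Pi.one_apply, one_mul, V.lintegral_potKernel a _ hx',
        V.lintegral_armKernel a _ hx', ← Finset.sum_mul, V.sum_posterior]
    · simp [hx]

end BinaryConfounder

/-! ### Realizations stay in the uncertainty set -/

section Realization

variable {Po : ProbabilityMeasure (FullData 𝒳 k)} (V : BinaryConfounder (outcomeKernel Po))

/-- The law of the full data with the observed-data law of `Po` in which `V` is the confounder. -/
def realization (V : BinaryConfounder (outcomeKernel Po)) : ProbabilityMeasure (FullData 𝒳 k) :=
  V.law (trtKernel Po) (covLaw Po) k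

/-- Mixing the arm laws over V given A = a restores the outcome kernel, because the weights sum to
one. -/
theorem obsLaw_realization (hk : 1 ≤ k) : obsLaw (realization V) = obsLaw Po := by
  refine Measure.ext_of_lintegral _ fun f hf => ?_
  have hm : Measurable fun o : FullData 𝒳 k => (covX o, obsY o, trtA o) := by fun_prop
  rw [obsLaw, obsLaw, lintegral_map hf hm, lintegral_map hf hm,
    lintegral_obs Po (g := fun x y a => f (x, y, a)) (by fun_prop)]
  refine (V.lintegral_law (trtKernel Po) (covLaw Po) hk (g := fun x y a => f (x, y a, a))
    (hf.comp (measurable_fst.prodMk ((measurable_apply_fin.comp measurable_snd).prodMk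
      (measurable_snd.comp measurable_snd))))).trans ?_
  congr with x
  have hx : ∀ a, Measurable fun y : ℝ => f (x, y, a) := fun a => by fun_prop
  simp only [fun a z => V.lintegral_potKernel a z (hx a), fun a z => V.lintegral_armKernel a z (hx a)]
  rw [V.marginal_mul_sum (trtKernel Po) x
    fun a v => ∫⁻ y, V.weight v (x, a) y * f (x, y, a) ∂outcomeKernel Po (x, a)]
  simp only [fun a => V.sum_lintegral_weight_mul (x, a) (hx a)]

/-- Posterior odds over prior odds equal the likelihood ratio of V between the arms, which does not
depend on X. -/
theorem marginalSensitivity_realization [StandardBorelSpace 𝒳] {Λ : ℝ} (hk : 1 ≤ k) (hΛ : 1 ≤ Λ)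
    (hPo : MarginalSensitivity Λ Po)
    (hV : ∀ v, 1 / Λ ≤ (V.prob 1 v).toReal / (V.prob 0 v).toReal ∧
      (V.prob 1 v).toReal / (V.prob 0 v).toReal ≤ Λ) :
    MarginalSensitivity Λ (realization V) := by
  refine ⟨V.condIndep_law _ _, ?_⟩
  have hobs := obsLaw_realization V hk
  have h1 := ae_trtKernel_ne_zero hΛ hPo
  rw [← covLaw_congr hobs] at h1
  have h2 := V.condDistrib_trtA_law (trtKernel Po) (covLaw Po) (k := k)
  rw [← V.map_law_covXU (trtKernel Po) (covLaw Po)] at h2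
  filter_upwards [ae_of_ae_map measurable_covX.aemeasurable h1,
    ae_of_ae_map measurable_covXU.aemeasurable h2,
    nominalProp_ae_eq (realization V) 0, nominalProp_ae_eq (realization V) 1,
    trueProp_ae_eq (realization V) 0, trueProp_ae_eq (realization V) 1] with o hp he n0 n1 t0 t1
  have he' : ∀ a, (trtKernelXU (realization V) (covXU o)).real {a} =
      (trtKernel Po (covX o)).real {a} * (V.prob a (BinaryConfounder.decode (confU o))).toReal /
        (V.marginal (trtKernel Po) (covX o) (BinaryConfounder.decode (confU o))).toReal := by
    intro a
    rw [realization, Measure.real, he, BinaryConfounder.postKernelXU, Kernel.comap_apply,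
      V.postKernel_singleton, BinaryConfounder.posterior, ENNReal.toReal_div, ENNReal.toReal_mul]
    rfl
  rw [n0, n1, t0, t1, he', he', trtKernel_congr hobs]
  set v := BinaryConfounder.decode (confU o)
  have hq : ∀ a, (trtKernel Po (covX o)).real {a} ≠ 0 := fun a =>
    (ENNReal.toReal_pos (hp a) (measure_ne_top _ _)).ne'
  have hm : (V.marginal (trtKernel Po) (covX o) v).toReal ≠ 0 :=
    (ENNReal.toReal_pos (V.marginal_ne_zero _ _ _) (V.marginal_ne_top _ _ _)).ne'
  have hc : ∀ a, (V.prob a v).toReal ≠ 0 := fun a =>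
    (ENNReal.toReal_pos (V.prob_ne_zero _ _) (V.prob_ne_top _ _)).ne'
  have : (trtKernel Po (covX o)).real {1} * (V.prob 1 v).toReal /
        (V.marginal (trtKernel Po) (covX o) v).toReal /
      ((trtKernel Po (covX o)).real {0} * (V.prob 0 v).toReal /
        (V.marginal (trtKernel Po) (covX o) v).toReal) /
      ((trtKernel Po (covX o)).real {1} / (trtKernel Po (covX o)).real {0}) =
      (V.prob 1 v).toReal / (V.prob 0 v).toReal := by
    have := hq 0; have := hq 1; have := hc 0; have := hc 1
    field_simp
  rw [this]
  exact hV v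

end Realization

/-! ### The extremal tail confounder -/

/-- The conditional probability of `V = v` given `A = a` for the extremal confounders. -/
def tailProb (Λ : ℝ) (a v : Fin 2) : ℝ≥0∞ :=
  ENNReal.ofReal (if a = v then 1 / (Λ + 1) else Λ / (Λ + 1))

theorem tailProb_pos {Λ : ℝ} (hΛ : 1 ≤ Λ) (a v : Fin 2) : 0 < tailProb Λ a v := by
  rw [tailProb, ENNReal.ofReal_pos]
  split_ifs <;> positivity

/-- The masses 1/(Λ+1) and Λ/(Λ+1) are the two-point probabilities with ratio Λ; swapping them
between arms makes both likelihood ratios extreme. -/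
theorem sum_tailProb {Λ : ℝ} (hΛ : 1 ≤ Λ) (a : Fin 2) : ∑ v, tailProb Λ a v = 1 := by
  have h1 : 1 / (Λ + 1) + Λ / (Λ + 1) = 1 := by field_simp; ring
  revert a
  simp only [Fin.forall_fin_two, Fin.sum_univ_two, tailProb, if_true, if_false, zero_ne_one,
    one_ne_zero]
  have h := ENNReal.ofReal_add (p := 1 / (Λ + 1)) (q := Λ / (Λ + 1)) (by positivity) (by positivity)
  rw [h1, ENNReal.ofReal_one] at h
  exact ⟨h.symm, (add_comm _ _).trans h.symm⟩

theorem sum_eq_add_one_sub (f : Fin 2 → ℝ≥0∞) (b : Fin 2) : ∑ v, f v = f b + f (1 - b) := by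
  revert b
  simp [Fin.forall_fin_two, Fin.sum_univ_two, add_comm]

theorem tailProb_lt_one {Λ : ℝ} (hΛ : 1 ≤ Λ) (a v : Fin 2) : tailProb Λ a v < 1 := by
  have h := sum_tailProb hΛ a
  rw [sum_eq_add_one_sub _ v] at h
  rw [← h]
  exact ENNReal.lt_add_right ENNReal.ofReal_ne_top (tailProb_pos hΛ _ _).ne'

theorem one_sub_ne_self (b : Fin 2) : 1 - b ≠ b := by
  revert b
  decide

theorem eq_one_sub_of_ne {v b : Fin 2} (h : v ≠ b) : v = 1 - b := by
  revert v b
  decide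

/-- The confounder that marks with `V = b` the upper tail of each conditional outcome law, at the
levels prescribed by `tailProb`. -/
theorem exists_tailConfounder {Λ : ℝ} (hΛ : 1 ≤ Λ) (F : Kernel (𝒳 × Fin 2) ℝ) [IsMarkovKernel F]
    (b : Fin 2) :
    ∃ (q : 𝒳 × Fin 2 → ℝ) (V : BinaryConfounder F), Measurable q ∧ V.prob = tailProb Λ ∧
      (∀ z y, q z < y → V.weight b z y = 1) ∧ ∀ z y, y < q z → V.weight (1 - b) z y = 1 := by
  obtain ⟨q, w, hq, hw, hw1, hlow, hup, hint⟩ := exists_upperTail F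
    (c := fun z => tailProb Λ z.2 b) ((measurable_of_countable fun a => tailProb Λ a b).comp
      measurable_snd) (fun z => tailProb_pos hΛ _ _) (fun z => tailProb_lt_one hΛ _ _)
  have hb := one_sub_ne_self b
  have hsum : ∀ z : 𝒳 × Fin 2, tailProb Λ z.2 b + tailProb Λ z.2 (1 - b) = 1 := fun z => by
    rw [← sum_tailProb hΛ z.2, sum_eq_add_one_sub _ b]
  refine ⟨q, ⟨tailProb Λ, fun a v => (tailProb_pos hΛ a v).ne', sum_tailProb hΛ,
    fun v z y => if v = b then w z y else 1 - w z y, fun v => ?_, fun z y => ?_, fun v z => ?_⟩,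
    hq, rfl, fun z y hy => ?_, fun z y hy => ?_⟩
  · by_cases hv : v = b
    · simpa only [hv, if_true] using hw
    · simp only [hv, if_false]
      exact measurable_const.sub hw
  · rw [sum_eq_add_one_sub _ b, if_pos rfl, if_neg hb, add_tsub_cancel_of_le (hw1 z y)]
  · by_cases hv : v = b
    · simpa only [hv, if_true] using hint z
    · obtain rfl := eq_one_sub_of_ne hv
      simp only [hv, if_false]
      rw [lintegral_sub hw.of_uncurry_left (by rw [hint]; exact ENNReal.ofReal_ne_top)
        (Eventually.of_forall fun y => hw1 z y), hint, lintegral_const, measure_univ, mul_one,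
        ← hsum z, ENNReal.add_sub_cancel_left (tailProb_lt_one hΛ _ _).ne_top]
  · simpa using hup z y hy
  · simp [hb, hlow z y hy]

/-- This quotient is the density of Y(a) where V = v. The likelihood ratio of the other arm to arm a
is Λ or Λ⁻¹, so the bounds of `lintegral_condLaw_bounds` are met exactly. -/
theorem marginal_div_prob {Λ : ℝ} (hΛ : 1 ≤ Λ) {F : Kernel (𝒳 × Fin 2) ℝ}
    (V : BinaryConfounder F) (hV : V.prob = tailProb Λ) (π : Kernel 𝒳 (Fin 2)) (x : 𝒳)
    (a v : Fin 2) :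
    V.marginal π x v / V.prob a v = armBound π (if a = v then Λ else Λ⁻¹) a x := by
  have hdiv : ∀ a v, tailProb Λ (1 - a) v / tailProb Λ a v =
      ENNReal.ofReal (if a = v then Λ else Λ⁻¹) := by
    intro a v
    have hne : 1 - a = v ↔ ¬ a = v := by revert a v; decide
    have h0 := ENNReal.ofReal_pos.1 (tailProb_pos hΛ a v)
    rw [tailProb, tailProb, ← ENNReal.ofReal_div_of_pos h0]
    congr 1
    by_cases h : a = v
    · rw [if_neg (by tauto), if_pos h, if_pos h]
      field_simp
    · rw [if_pos (by tauto), if_neg h, if_neg h]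
      field_simp
  rw [BinaryConfounder.marginal, sum_eq_add_one_sub _ a, armBound, ENNReal.add_div,
    mul_div_assoc, mul_div_assoc, hV, hdiv, ENNReal.div_self (tailProb_pos hΛ a v).ne'
    ENNReal.ofReal_ne_top, mul_one, mul_comm (ENNReal.ofReal _)]

/-- On the part of the line that a tail confounder marks with `V = v`, the conditional law of `Y(a)`
under its realization is an extreme multiple of the outcome law. -/
theorem lintegral_condLaw_realization {Λ : ℝ} (hk : 1 ≤ k) (hΛ : 1 ≤ Λ)
    {Po : ProbabilityMeasure (FullData 𝒳 k)} (V : BinaryConfounder (outcomeKernel Po))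
    (hV : V.prob = tailProb Λ) (a v : Fin 2) {h : 𝒳 × ℝ → ℝ≥0∞} (hh : Measurable h)
    (hw : ∀ x y, h (x, y) ≠ 0 → V.weight v (x, a) y = 1) :
    ∀ᵐ x ∂covLaw Po, ∫⁻ y, h (x, y) ∂condLaw (realization V) a x =
      armBound (trtKernel Po) (if a = v then Λ else Λ⁻¹) a x *
        ∫⁻ y, h (x, y) ∂outcomeKernel Po (x, a) := by
  filter_upwards [V.condLaw_law (trtKernel Po) (covLaw Po) hk a hh] with x hx
  have h1 : ∀ y, V.weight v (x, a) y * h (x, y) = h (x, y) := fun y => by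
    by_cases h0 : h (x, y) = 0
    · simp [h0]
    · rw [hw x y h0, one_mul]
  have h2 : ∀ y, V.weight (1 - v) (x, a) y * h (x, y) = 0 := fun y => by
    by_cases h0 : h (x, y) = 0
    · simp [h0]
    · have hs := V.sum_weight (x, a) y
      rw [sum_eq_add_one_sub _ v, hw x y h0] at hs
      have : V.weight (1 - v) (x, a) y = 0 :=
        (ENNReal.add_right_inj ENNReal.one_ne_top).1 (hs.trans (add_zero 1).symm)
      rw [this, zero_mul]
  rw [realization, hx, sum_eq_add_one_sub _ v]
  simp only [h1, h2, lintegral_zero, ENNReal.zero_div, mul_zero, add_zero]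
  rw [← marginal_div_prob hΛ V hV]
  simp only [div_eq_mul_inv]
  ring

/-! ### Finite first moments -/

section Integrability

variable {Po Q : ProbabilityMeasure (FullData 𝒳 k)} {Λ : ℝ}

/-- The part of E|Y| on A = a is the mean of p_a ∫ |y| dF_a, and p_a is a.s. nonzero. -/
theorem ae_integrable_outcomeKernel [StandardBorelSpace 𝒳] (hΛ : 1 ≤ Λ)
    (hPo : MarginalSensitivity Λ Po)
    (hY : Integrable obsY (Po : Measure (FullData 𝒳 k))) (a : Fin 2) :
    ∀ᵐ x ∂covLaw Po, ∫⁻ y, ‖y‖ₑ ∂outcomeKernel Po (x, a) < ∞ := by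
  have hm : Measurable fun p : 𝒳 × ℝ => ‖p.2‖ₑ := by fun_prop
  have h1 := lintegral_obs_arm Po a hm
  have h2 : ∫⁻ o, (if trtA o = a then ‖potY o a‖ₑ else 0) ∂(Po : Measure (FullData 𝒳 k)) < ∞ := by
    refine lt_of_le_of_lt (lintegral_mono fun o => ?_) hY.2
    split_ifs with h
    · rw [obsY, h]
    · exact zero_le
  rw [h1] at h2
  have hF : Measurable fun x => ∫⁻ y, ‖y‖ₑ ∂outcomeKernel Po (x, a) :=
    Measurable.lintegral_kernel_prod_right' (κ := (outcomeKernel Po).comap (fun x => (x, a))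
      (by fun_prop)) hm
  have h3 := ae_lt_top (((trtKernel Po).measurable_coe (measurableSet_singleton a)).mul hF) h2.ne
  filter_upwards [h3, ae_trtKernel_ne_zero hΛ hPo] with x hx h0
  exact ENNReal.lt_top_of_mul_ne_top_right hx.ne (h0 a)

theorem ae_integrable_condLaw [StandardBorelSpace 𝒳] (hΛ : 1 ≤ Λ)
    (hPo : MarginalSensitivity Λ Po)
    (hY : Integrable obsY (Po : Measure (FullData 𝒳 k)))
    (hQ : Q ∈ uncertaintySet k Λ (obsLaw Po)) (a : Fin 2) :
    ∀ᵐ x ∂covLaw Po, Integrable (fun y : ℝ => y) (condLaw Q a x) := by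
  have hm : Measurable fun p : 𝒳 × ℝ => ‖p.2‖ₑ := by fun_prop
  have h := lintegral_condLaw_bounds hΛ hQ.1 a hm
  rw [covLaw_congr hQ.2, trtKernel_congr hQ.2, outcomeKernel_congr hQ.2] at h
  filter_upwards [h, ae_integrable_outcomeKernel hΛ hPo hY a] with x hx h1
  refine ⟨measurable_id.aestronglyMeasurable, lt_of_le_of_lt hx.2 (ENNReal.mul_lt_top ?_ h1)⟩
  exact ENNReal.add_lt_top.2 ⟨measure_lt_top _ _,
    ENNReal.mul_lt_top ENNReal.ofReal_lt_top (measure_lt_top _ _)⟩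

end Integrability

/-! ### Extremal laws and the bounds -/

theorem measurable_condMean (Q : ProbabilityMeasure (FullData 𝒳 k)) (a : Fin 2) :
    Measurable (condMean Q a) :=
  (stronglyMeasurable_id.integral_kernel (κ := condLaw Q a)).measurable

/-- A law in the uncertainty set that at once maximizes the conditional mean of `Y(b)` and minimizes
the conditional mean of the other potential outcome. -/
theorem exists_extremal [StandardBorelSpace 𝒳] (hk : 1 ≤ k) {Λ : ℝ} (hΛ : 1 ≤ Λ)
    {Po : ProbabilityMeasure (FullData 𝒳 k)} (hPo : MarginalSensitivity Λ Po)
    (hY : Integrable obsY (Po : Measure (FullData 𝒳 k))) (b : Fin 2) :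
    ∃ R ∈ uncertaintySet k Λ (obsLaw Po), ∀ Q ∈ uncertaintySet k Λ (obsLaw Po),
      (∀ᵐ x ∂covLaw Po, condMean Q b x ≤ condMean R b x) ∧
      ∀ᵐ x ∂covLaw Po, condMean R (1 - b) x ≤ condMean Q (1 - b) x := by
  obtain ⟨q, V, hq, hV, hup, hlow⟩ := exists_tailConfounder hΛ (outcomeKernel Po) b
  have hbb := one_sub_ne_self b
  have hΛ0 : 0 < Λ := by linarith
  have hodds : ∀ v, 1 / Λ ≤ (V.prob 1 v).toReal / (V.prob 0 v).toReal ∧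
      (V.prob 1 v).toReal / (V.prob 0 v).toReal ≤ Λ := by
    have hle : 1 / Λ ≤ Λ := by
      rw [div_le_iff₀ hΛ0]
      nlinarith
    have h1 : 1 / (Λ + 1) / (Λ / (Λ + 1)) = 1 / Λ := by field_simp
    have h2 : Λ / (Λ + 1) / (1 / (Λ + 1)) = Λ := by field_simp
    have hp : 0 ≤ 1 / (Λ + 1) := by positivity
    have hp' : 0 ≤ Λ / (Λ + 1) := by positivity
    rw [hV, Fin.forall_fin_two]
    simp only [tailProb, if_true, if_false, zero_ne_one, one_ne_zero, ENNReal.toReal_ofReal hp,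
      ENNReal.toReal_ofReal hp', h1, h2]
    exact ⟨⟨hle, le_rfl⟩, le_rfl, hle⟩
  have hR : realization V ∈ uncertaintySet k Λ (obsLaw Po) :=
    ⟨marginalSensitivity_realization V hk hΛ hPo hodds, obsLaw_realization V hk⟩
  have hpos : ∀ a, Measurable fun p : 𝒳 × ℝ => ENNReal.ofReal (p.2 - q (p.1, a)) := fun a => by
    fun_prop
  have hneg : ∀ a, Measurable fun p : 𝒳 × ℝ => ENNReal.ofReal (q (p.1, a) - p.2) := fun a => by
    fun_prop
  have hRpos := fun a => lintegral_condLaw_realization hk hΛ V hV a b (hpos a)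
    fun x y h => hup _ _ (by simpa using h)
  have hRneg := fun a => lintegral_condLaw_realization hk hΛ V hV a (1 - b) (hneg a)
    fun x y h => hlow _ _ (by simpa using h)
  refine ⟨realization V, hR, fun Q hQ => ?_⟩
  have bound : ∀ a {f : 𝒳 × ℝ → ℝ≥0∞}, Measurable f → _ := fun a f hf =>
    lintegral_condLaw_bounds hΛ hQ.1 a hf
  -- The density bounds involve only the observed law, so they are the same for `Q` as for `Po`.
  rw [covLaw_congr hQ.2, trtKernel_congr hQ.2, outcomeKernel_congr hQ.2] at bound
  constructor
  · filter_upwards [hRpos b, hRneg b, bound b (hpos b), bound b (hneg b),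
      ae_integrable_condLaw hΛ hPo hY hQ b, ae_integrable_condLaw hΛ hPo hY hR b]
      with x r1 r2 b1 b2 i1 i2
    rw [if_pos rfl] at r1
    rw [if_neg hbb.symm] at r2
    exact integral_id_le_of_lintegral_le i1 i2 (q (x, b)) (b1.2.trans r1.ge) (r2.le.trans b2.1)
  · filter_upwards [hRpos (1 - b), hRneg (1 - b), bound (1 - b) (hpos (1 - b)),
      bound (1 - b) (hneg (1 - b)),
      ae_integrable_condLaw hΛ hPo hY hQ (1 - b), ae_integrable_condLaw hΛ hPo hY hR (1 - b)]
      with x r1 r2 b1 b2 i1 i2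
    -- In arm `1 - b` the upper tail is marked by the opposite label, so it carries the smallest
    -- density and the lower tail the largest: the comparison reverses.
    rw [if_neg hbb] at r1
    rw [if_pos rfl] at r2
    exact integral_id_le_of_lintegral_le i2 i1 (q (x, 1 - b)) (r1.le.trans b1.1)
      (b2.2.trans r2.ge)

/-- An upper bound that is attained is automatically the least one. -/
theorem isFamilyEssSup_of_mem {ν : Measure 𝒳} {F : Set (𝒳 → ℝ)} {g : 𝒳 → ℝ} (hg : Measurable g)
    (hmem : g ∈ F) (hle : ∀ f ∈ F, ∀ᵐ x ∂ν, f x ≤ g x) : IsFamilyEssSup ν F g :=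
  ⟨hg, hle, fun _ _ h => h g hmem⟩

theorem isFamilyEssInf_of_mem {ν : Measure 𝒳} {F : Set (𝒳 → ℝ)} {g : 𝒳 → ℝ} (hg : Measurable g)
    (hmem : g ∈ F) (hge : ∀ f ∈ F, ∀ᵐ x ∂ν, g x ≤ f x) : IsFamilyEssInf ν F g :=
  ⟨hg, hge, fun _ _ h => h g hmem⟩

end MSM

end

theorem propositionA2 {𝒳 : Type*} [MeasurableSpace 𝒳] [StandardBorelSpace 𝒳]
    {k : ℕ} (hk : 1 ≤ k) {Λ : ℝ} (hΛ : 1 ≤ Λ)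
    (Po : ProbabilityMeasure (MSM.FullData 𝒳 k))
    (hMSM : MSM.MarginalSensitivity Λ Po)
    (hY : Integrable MSM.obsY (Po : Measure (MSM.FullData 𝒳 k))) :
    (∀ Q ∈ MSM.uncertaintySet k Λ (MSM.obsLaw Po), ∀ a : Fin 2,
      ∀ᵐ x ∂(MSM.covLaw Po), Integrable (fun y : ℝ => y) (MSM.condLaw Q a x)) ∧
    ∃ (muLow muUp : 𝒳 → Fin 2 → ℝ) (tauLow tauUp : 𝒳 → ℝ),
      (∀ a : Fin 2,
        MSM.IsFamilyEssInf (MSM.covLaw Po)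
          {f | ∃ Q ∈ MSM.uncertaintySet k Λ (MSM.obsLaw Po), f = MSM.condMean Q a}
          (fun x => muLow x a) ∧
        MSM.IsFamilyEssSup (MSM.covLaw Po)
          {f | ∃ Q ∈ MSM.uncertaintySet k Λ (MSM.obsLaw Po), f = MSM.condMean Q a}
          (fun x => muUp x a)) ∧
      MSM.IsFamilyEssInf (MSM.covLaw Po)
        {f | ∃ Q ∈ MSM.uncertaintySet k Λ (MSM.obsLaw Po), f = MSM.cate Q} tauLow ∧
      MSM.IsFamilyEssSup (MSM.covLaw Po)
        {f | ∃ Q ∈ MSM.uncertaintySet k Λ (MSM.obsLaw Po), f = MSM.cate Q} tauUp ∧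
      (∃ Pup ∈ MSM.uncertaintySet k Λ (MSM.obsLaw Po),
        ∀ᵐ x ∂(MSM.covLaw Po), MSM.cate Pup x = tauUp x) ∧
      (∃ Plow ∈ MSM.uncertaintySet k Λ (MSM.obsLaw Po),
        ∀ᵐ x ∂(MSM.covLaw Po), MSM.cate Plow x = tauLow x) ∧
      (∀ᵐ x ∂(MSM.covLaw Po), tauUp x = muUp x 1 - muLow x 0) ∧
      (∀ᵐ x ∂(MSM.covLaw Po), tauLow x = muLow x 1 - muUp x 0) := by
  refine ⟨fun Q hQ a => MSM.ae_integrable_condLaw hΛ hMSM hY hQ a, ?_⟩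
  choose R hR hext using MSM.exists_extremal hk hΛ hMSM hY
  have hmax : ∀ a, ∀ Q ∈ MSM.uncertaintySet k Λ (MSM.obsLaw Po),
      ∀ᵐ x ∂(MSM.covLaw Po), MSM.condMean Q a x ≤ MSM.condMean (R a) a x :=
    fun a Q hQ => (hext a Q hQ).1
  have hmin : ∀ a, ∀ Q ∈ MSM.uncertaintySet k Λ (MSM.obsLaw Po),
      ∀ᵐ x ∂(MSM.covLaw Po), MSM.condMean (R (1 - a)) a x ≤ MSM.condMean Q a x := by
    intro a Q hQ
    have h := (hext (1 - a) Q hQ).2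
    rwa [sub_sub_cancel] at h
  have hmeas : ∀ Q : ProbabilityMeasure (MSM.FullData 𝒳 k), Measurable (MSM.cate Q) := fun Q =>
    (MSM.measurable_condMean Q 1).sub (MSM.measurable_condMean Q 0)
  -- `R 1` supplies both the upper mean for a = 1 and the lower mean for a = 0, and `R 0` the other
  -- two, so the difference formulas hold by definition.
  refine ⟨fun x a => MSM.condMean (R (1 - a)) a x, fun x a => MSM.condMean (R a) a x,
    MSM.cate (R 0), MSM.cate (R 1), fun a => ⟨?_, ?_⟩, ?_, ?_, ⟨R 1, hR 1, ae_of_all _ fun _ => rfl⟩,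
    ⟨R 0, hR 0, ae_of_all _ fun _ => rfl⟩, ae_of_all _ fun _ => rfl, ae_of_all _ fun _ => rfl⟩
  · refine MSM.isFamilyEssInf_of_mem (MSM.measurable_condMean _ _) ⟨_, hR (1 - a), rfl⟩ ?_
    rintro _ ⟨Q, hQ, rfl⟩
    exact hmin a Q hQ
  · refine MSM.isFamilyEssSup_of_mem (MSM.measurable_condMean _ _) ⟨_, hR a, rfl⟩ ?_
    rintro _ ⟨Q, hQ, rfl⟩
    exact hmax a Q hQ
  · refine MSM.isFamilyEssInf_of_mem (hmeas _) ⟨_, hR 0, rfl⟩ ?_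
    rintro _ ⟨Q, hQ, rfl⟩
    filter_upwards [hmin 1 Q hQ, hmax 0 Q hQ] with x h1 h0
    exact sub_le_sub h1 h0
  · refine MSM.isFamilyEssSup_of_mem (hmeas _) ⟨_, hR 1, rfl⟩ ?_
    rintro _ ⟨Q, hQ, rfl⟩
    filter_upwards [hmax 1 Q hQ, hmin 0 Q hQ] with x h1 h0
    exact sub_le_sub h1 h0
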